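/- Let $k,p\ge 1$, $m\ge 0$, $\varepsilon>0$, $R\in\mathbb R$, and let $\Gamma\in\mathbb R^{p\times p}$ be symmetric positive definite with smallest eigenvalue $\lambda_{\min}(\Gamma)$. Put $\|u\|_\Gamma^2=u^T\Gamma^{-1}u$. For $t\in\mathbb R^p$ let $\mu_t$ be the measure $d\mu_t(x)=e^{-\frac12\|x-t\|_\Gamma^2}dx$, and let $\partial_w\mu_t$ be its derivative with respect to $t$ in the direction $w$, i.e. the signed measure with density $x\mapsto w^T\Gamma^{-1}(x-t)e^{-\frac12\|x-t\|_\Gamma^2}$. For $\theta=(a_1,\dots,a_k,t_1,\dots,t_k)\in\mathbb R^{k(p+1)}$ (with the Euclidean norm) let $\phi(\theta)=\sum_{i=1}^k a_i\mu_{t_i}$, and for $\eta>0$ put $$\Theta_{k,\eta}=\{\theta:\ \|t_i-t_j\|_\Gamma>\eta\ (i\ne j),\ \|t_i\|_2<R\},\qquad \Sigma_{k,\eta,\Gamma}=\phi(\Theta_{k,\eta}).$$ Let $K(t,s)=c\,e^{-\frac1{2r}\|t-s\|_\Gamma^2}$ ($c,r>0$) be a Gaussian kernel with covariance proportional to $\Gamma$,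 and let $\|\nu\|_K^2=\iint K(t,s)\,d\nu(t)\,d\nu(s)$ for finite signed measures $\nu$ on $\mathbb R^p$. Assume that $\|\mu_t\|_K=1$ for all $t$, and that there is $c_K<1$ such that for all $t_1,\dots,t_k\in\mathbb R^p$ with $\|t_i-t_j\|_\Gamma>\varepsilon$ for $i\neq j$ and all $v_i,a_i\in\mathbb R$, $w_i\in\mathbb R^p$, $$\Big\|\sum_i (v_i\mu_{t_i}+a_i\partial_{w_i}\mu_{t_i})\Big\|_K^2\ \ge\ (1-c_K)\sum_i\|v_i\mu_{t_i}+a_i\partial_{w_i}\mu_{t_i}\|_K^2 .$$ Let $\alpha_1,\dots,\alpha_m$ be bounded continuous functions $\mathbb R^p\to\mathbb C$ (for example Fourier measurements), and let $A\nu=(\int\alpha_l\,d\nu)_{1\le l\le m}\in\mathbb C^m$. Assume that, for some $\gamma<1$, $$(1-\gamma)\|\nu\|_K^2\le\|A\nu\|_2^2\le(1+\gamma)\|\nu\|_K^2\qquad\text{for all }\nu\in\Sigma_{k,\varepsilon/2,\Gamma}-\Sigma_{k,\varepsilon/2,\Gamma}.$$ Let $y=Ax_0$ with $x_0\in\Sigma_{k,\varepsilon,\Gamma}$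 (no noise), let $g(\theta)=\|A\phi(\theta)-y\|_2^2$, and let $\theta^*=(a_1,\dots,a_k,t_1,\dots,t_k)\in\Theta_{k,\varepsilon}$ be a minimizer of $g$ over $\Theta_{k,\varepsilon}$ with $0<|a_1|\le|a_2|\le\dots\le|a_k|$. Put $$\beta_0=\min\Big(\frac{\varepsilon\sqrt{\lambda_{\min}(\Gamma)}}8,\frac{|a_1|}2\Big),\qquad \beta_{GMM}=\min\left(\beta_0,\ \frac{(1-\gamma)(1-c_K)\min(1,d_K|a_1|^2)}{8\,C_{\phi,\theta^*}\sqrt{1+\gamma}\,\big(\sqrt{1+\gamma}\sqrt{1+c_K}\sqrt{D_K}+2|a_k|D'_{A,K}\big)}\right),$$ where $d_K$ is the largest constant with $\|\partial_w\mu_0\|_K^2\ge d_K\|w\|_2^2$ for all $w$; $C_{\phi,\theta^*}$ is the smallest constant with $\|\phi(\theta)-\phi(\theta^*)\|_K\le C_{\phi,\theta^*}\|\theta-\theta^*\|_2$ whenever $\|\theta-\theta^*\|_2<2\beta_0$; and $$D_K=\iint K(t,s)\|\Gamma^{-1}s\|_2\|\Gamma^{-1}t\|_2e^{-\frac12\|s\|_\Gamma^2}e^{-\frac12\|t\|_\Gamma^2}dt\,ds,$$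 $$D'_{A,K}=\sqrt{\sum_{l}\sup_t|\alpha_l(t)|^2}\ \max\Big(\frac1{\lambda_{\min}(\Gamma)}\int e^{-\frac12\|t\|_\Gamma^2}dt,\ \int\|\Gamma^{-1}t\|_2e^{-\frac12\|t\|_\Gamma^2}dt\Big).$$ Suppose moreover that $\|t_i\|_2\le R-2\beta_{GMM}$ for all $i$. Then $\Lambda=\{\theta:\|\theta-\theta^*\|_2<\beta_{GMM}\}$ is a $g$-basin of attraction of $\theta^*$: $\theta^*\in\Lambda$ (that is, $\beta_{GMM}>0$), and there is a fixed step $\tau>0$ such that for every $\theta_0\in\Lambda$ the gradient descent $\theta_{n+1}=\theta_n-\tau\nabla g(\theta_n)$ satisfies $g(\theta_n)\to g(\theta^*)$. -/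

import Mathlib

open MeasureTheory MeasureTheory.VectorMeasure Filter Topology BoundedContinuousFunction
open scoped Matrix

namespace GMM

/-- `ℝ^p` with its Euclidean norm. -/
abbrev Space (p : ℕ) : Type := EuclideanSpace ℝ (Fin p)

/-- The parameter space `ℝ^{k(p+1)}` with its Euclidean norm: a parameter `θ` consists of the
amplitudes `θ.fst i` and the means `θ.snd i`, for `i : Fin k`. -/
abbrev Param (k p : ℕ) : Type :=
  WithLp 2 (EuclideanSpace ℝ (Fin k) × PiLp 2 (fun _ : Fin k => Space p))

noncomputable section

/-! ### Gaussian measures and mixtures -/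

/-- The vector `Γ⁻¹ u`. -/
def precMul {p : ℕ} (Γ : Matrix (Fin p) (Fin p) ℝ) (u : Space p) : Space p :=
  WithLp.toLp 2 (Γ⁻¹ *ᵥ u.ofLp)

/-- The squared Mahalanobis norm `‖u‖_Γ² = uᵀ Γ⁻¹ u`. -/
def mahalSq {p : ℕ} (Γ : Matrix (Fin p) (Fin p) ℝ) (u : Space p) : ℝ :=
  inner ℝ u (precMul Γ u)

/-- The Mahalanobis norm `‖u‖_Γ`. -/
def mahal {p : ℕ} (Γ : Matrix (Fin p) (Fin p) ℝ) (u : Space p) : ℝ :=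
  √(mahalSq Γ u)

/-- The unnormalized Gaussian density `x ↦ exp(-‖x - t‖_Γ² / 2)`. -/
def gaussianDensity {p : ℕ} (Γ : Matrix (Fin p) (Fin p) ℝ) (t x : Space p) : ℝ :=
  Real.exp (-(1 / 2) * mahalSq Γ (x - t))

/-- The Gaussian measure `μ_t`, as a finite signed measure on `ℝ^p`. -/
def gaussian {p : ℕ} (Γ : Matrix (Fin p) (Fin p) ℝ) (t : Space p) : SignedMeasure (Space p) :=
  (volume : Measure (Space p)).withDensityᵥ (gaussianDensity Γ t)

/-- The directional derivative `∂_w μ_t` of `μ_t` with respect to its mean `t` in the direction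
`w`: the finite signed measure with density `x ↦ wᵀ Γ⁻¹ (x - t) exp(-‖x - t‖_Γ² / 2)`, which is
the derivative at `h = 0` of the density of `μ_{t + h w}`. -/
def dGaussian {p : ℕ} (Γ : Matrix (Fin p) (Fin p) ℝ) (w t : Space p) :
    SignedMeasure (Space p) :=
  (volume : Measure (Space p)).withDensityᵥ
    (fun x => inner ℝ w (precMul Γ (x - t)) * gaussianDensity Γ t x)

/-- The parametrization `φ(a, t) = ∑ i, a_i μ_{t_i}`. -/
def phi {k p : ℕ} (Γ : Matrix (Fin p) (Fin p) ℝ) (θ : Param k p) : SignedMeasure (Space p) :=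
  ∑ i, θ.fst i • gaussian Γ (θ.snd i)

/-- The constraint set `Θ_{k,ε}`: means in the open ball of radius `R`, pairwise separated by more
than `ε` for `‖·‖_Γ`. -/
def Theta (k : ℕ) {p : ℕ} (Γ : Matrix (Fin p) (Fin p) ℝ) (ε R : ℝ) : Set (Param k p) :=
  {θ | (∀ i j, i ≠ j → ε < mahal Γ (θ.snd i - θ.snd j)) ∧ ∀ i, ‖θ.snd i‖ < R}

/-- The model set `Σ_{k,ε,Γ}` of `ε`-separated mixtures. -/
def Model (k : ℕ) {p : ℕ} (Γ : Matrix (Fin p) (Fin p) ℝ) (ε R : ℝ) :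
    Set (SignedMeasure (Space p)) :=
  phi Γ '' Theta k Γ ε R

/-- The secant set `S - S` of a set of signed measures. -/
def secants {p : ℕ} (S : Set (SignedMeasure (Space p))) : Set (SignedMeasure (Space p)) :=
  {ν | ∃ x ∈ S, ∃ y ∈ S, ν = x - y}

/-! ### Kernel metric -/

/-- The Gaussian kernel with covariance `r • Γ`, up to the factor `c`:
`K(t, s) = c * exp(-‖t - s‖_Γ² / (2 r))`. -/
def gaussianKernel {p : ℕ} (Γ : Matrix (Fin p) (Fin p) ℝ) (c r : ℝ) (t s : Space p) : ℝ :=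
  c * Real.exp (-(1 / (2 * r)) * mahalSq Γ (t - s))

/-- The squared kernel norm `‖ν‖_K² = ∫∫ K(t, s) dν(t) dν(s)` of a finite signed measure. -/
def kernelNormSq {p : ℕ} (K : Space p → Space p → ℝ) (ν : SignedMeasure (Space p)) : ℝ :=
  ∫ᵛ t, (∫ᵛ s, K t s ∂<•ν) ∂<•ν

/-- The kernel norm `‖ν‖_K`. -/
def kernelNorm {p : ℕ} (K : Space p → Space p → ℝ) (ν : SignedMeasure (Space p)) : ℝ :=
  √(kernelNormSq K ν)

/-- The assumption on the kernel: all `μ_t` have kernel norm one, and `K` has mutual coherence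
constant `cK` on `k`-tuples of `ε`-separated positions. -/
structure KernelAssumption {p : ℕ} (k : ℕ) (Γ : Matrix (Fin p) (Fin p) ℝ)
    (K : Space p → Space p → ℝ) (ε cK : ℝ) : Prop where
  norm_gaussian : ∀ t : Space p, kernelNorm K (gaussian Γ t) = 1
  coherence : ∀ t : Fin k → Space p, (∀ i j, i ≠ j → ε < mahal Γ (t i - t j)) →
    ∀ (v a : Fin k → ℝ) (w : Fin k → Space p),
      (1 - cK) * ∑ i, kernelNormSq K (v i • gaussian Γ (t i) + a i • dGaussian Γ (w i) (t i))
        ≤ kernelNormSq K (∑ i, (v i • gaussian Γ (t i) + a i • dGaussian Γ (w i) (t i)))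

/-! ### Measurements -/

/-- The measurement operator `(A ν)_l = ⟨ν, α_l⟩ = ∫ α_l dν` defined by bounded continuous
functions `α_1, …, α_m`. -/
def measure {p m : ℕ} (α : Fin m → (Space p →ᵇ ℂ)) (ν : SignedMeasure (Space p)) :
    EuclideanSpace ℂ (Fin m) :=
  WithLp.toLp 2 (fun l => ∫ᵛ x, α l x ∂<•ν)

/-- `A` has the restricted isometry property with constant `γ` on the set `T`, with respect to the
kernel norm. -/
def HasRIP {p m : ℕ} (α : Fin m → (Space p →ᵇ ℂ)) (K : Space p → Space p → ℝ)
    (T : Set (SignedMeasure (Space p))) (γ : ℝ) : Prop :=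
  ∀ ν ∈ T, (1 - γ) * kernelNormSq K ν ≤ ‖measure α ν‖ ^ 2 ∧
    ‖measure α ν‖ ^ 2 ≤ (1 + γ) * kernelNormSq K ν

/-- The objective function `g(θ) = ‖A φ(θ) - y‖₂²`. -/
def objective {k p m : ℕ} (Γ : Matrix (Fin p) (Fin p) ℝ) (α : Fin m → (Space p →ᵇ ℂ))
    (y : EuclideanSpace ℂ (Fin m)) (θ : Param k p) : ℝ :=
  ‖measure α (phi Γ θ) - y‖ ^ 2

/-! ### Basins of attraction -/

/-- `Λ` is a `g`-basin of attraction of `θs ∈ Λ`: for some fixed step `τ > 0`, the values of `g`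
along the gradient descent started anywhere in `Λ` converge to `g θs`. -/
def IsBasin {k p : ℕ} (g : Param k p → ℝ) (θs : Param k p) (Λ : Set (Param k p)) : Prop :=
  θs ∈ Λ ∧ ∃ τ : ℝ, 0 < τ ∧ ∀ θ₀ ∈ Λ,
    Tendsto (fun n : ℕ => g ((fun θ => θ - τ • gradient g θ)^[n] θ₀)) atTop (𝓝 (g θs))

/-! ### The constants -/

/-- The smallest eigenvalue of a symmetric matrix. -/
def lambdaMin {p : ℕ} {Γ : Matrix (Fin p) (Fin p) ℝ} (hΓ : Γ.IsHermitian) : ℝ :=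
  ⨅ i, hΓ.eigenvalues i

/-- The largest constant `d_K` such that `‖∂_w μ_t‖_K² ≥ d_K ‖w‖₂²` for all `w` (the left-hand side
does not depend on `t` for a translation-invariant kernel). -/
def dConst {p : ℕ} (Γ : Matrix (Fin p) (Fin p) ℝ) (K : Space p → Space p → ℝ) : ℝ :=
  sInf ((fun w => kernelNormSq K (dGaussian Γ w 0)) '' Metric.sphere (0 : Space p) 1)

/-- `D_K = ∫∫ K(t, s) ‖Γ⁻¹ s‖₂ ‖Γ⁻¹ t‖₂ exp(-‖s‖_Γ² / 2) exp(-‖t‖_Γ² / 2) dt ds`. -/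
def DConst {p : ℕ} (Γ : Matrix (Fin p) (Fin p) ℝ) (K : Space p → Space p → ℝ) : ℝ :=
  ∫ s : Space p, ∫ t : Space p,
    K t s * ‖precMul Γ s‖ * ‖precMul Γ t‖ * gaussianDensity Γ 0 s * gaussianDensity Γ 0 t

/-- `D'_{A,K} = √(∑ l, sup |α_l|²) * max (λ_min(Γ)⁻¹ ∫ exp(-‖t‖_Γ² / 2) dt)
(∫ ‖Γ⁻¹ t‖₂ exp(-‖t‖_Γ² / 2) dt)`. -/
def DAConst {p m : ℕ} {Γ : Matrix (Fin p) (Fin p) ℝ} (hΓ : Γ.IsHermitian)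
    (α : Fin m → (Space p →ᵇ ℂ)) : ℝ :=
  √(∑ l, ‖α l‖ ^ 2) *
    max (1 / lambdaMin hΓ * ∫ t : Space p, gaussianDensity Γ 0 t)
      (∫ t : Space p, ‖precMul Γ t‖ * gaussianDensity Γ 0 t)

/-- The smallest constant `C` such that `‖φ(θ) - φ(θs)‖_K ≤ C ‖θ - θs‖₂` for all `θ` at distance
less than `ρ` from `θs`. -/
def lipConst {k p : ℕ} (Γ : Matrix (Fin p) (Fin p) ℝ) (K : Space p → Space p → ℝ)
    (θs : Param k p) (ρ : ℝ) : ℝ :=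
  sSup ((fun θ => kernelNorm K (phi Γ θ - phi Γ θs) / ‖θ - θs‖) ''
    {θ | θ ≠ θs ∧ ‖θ - θs‖ < ρ})

/-- The first two terms of the minimum that defines the radius of the basin. -/
def betaZero {k p : ℕ} [NeZero k] {Γ : Matrix (Fin p) (Fin p) ℝ} (hΓ : Γ.IsHermitian)
    (ε : ℝ) (θs : Param k p) : ℝ :=
  min (ε * √(lambdaMin hΓ) / 8) (|θs.fst 0| / 2)

/-- The radius of the basin (`0` is the first and `⊤` the last index of `Fin k`). -/
def betaGMM {k p m : ℕ} [NeZero k] {Γ : Matrix (Fin p) (Fin p) ℝ} (hΓ : Γ.IsHermitian)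
    (α : Fin m → (Space p →ᵇ ℂ)) (K : Space p → Space p → ℝ) (ε γ cK : ℝ) (θs : Param k p) : ℝ :=
  min (betaZero hΓ ε θs)
    ((1 - γ) * (1 - cK) * min 1 (dConst Γ K * |θs.fst 0| ^ 2) /
      (8 * lipConst Γ K θs (2 * betaZero hΓ ε θs) * √(1 + γ) *
        (√(1 + γ) * √(1 + cK) * √(DConst Γ K) + 2 * |θs.fst ⊤| * DAConst hΓ α)))

end

end GMM

/-! Write $e=\theta-\theta^*$ and $h(s)=A\phi(\theta^*+se)$. Data are noiseless and $x_0$ is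
feasible, so the minimum of $g$ is $0$ and $A\phi(\theta^*)=y$. Hence $\langle\nabla
g(\theta),e\rangle=2\langle h(1)-h(0),h'(1)\rangle$. If $h$ is nearly affine on $[0,1]$, this is
about $2\|h'(0)\|^2$, so the gradient is strongly monotone towards $\theta^*$. The gradient is also
at most a constant times $\|e\|$, and a small fixed step then contracts the distance to $\theta^*$
(`isBasin_of_inner_gradient_ge`).

It remains to compare $h''$ with $h'(0)$. Densities live in $L^1$, where $A$ and the bilinear form
of $K$ are continuous and the mixture is differentiable in its parameters. The isometry property
therefore passes from secants to tangent vectors (`HasRIP.mixL1Deriv`).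

For the lower bound, completing the square gives the kernel products of Gaussians explicitly. It
shows that $\mu_t\perp\partial_w\mu_t$, and coherence then yields $\|h'(0)\|\ge\kappa\|e\|$ with
$\kappa^2=(1-\gamma)(1-c_K)\min(1,d_K|a_1|^2)$.

For the upper bound, $h''$ has two kinds of terms. Those in $\partial_w\mu_t$ are themselves
tangent, so the isometry property and $D_K$ bound them. Those in the second derivative of $\mu_t$
are bounded in $L^1$, which is where $D'_{A,K}$ enters (`norm_measureCLM_mixL1Deriv₂_le`).

Comparing the two isometry bounds at $\theta^*$ gives $\kappa\le\sqrt{1+\gamma}\,C_{\phi,\theta^*}$.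
The definition of $\beta_{GMM}$ then forces $\|h''\|\le\frac15\|h'(0)\|$ on the whole segment, which
suffices for the monotonicity (`inner_sub_deriv_ge`). -/

namespace GMM

noncomputable section

/-! ### Signed measures with $L^1$ densities: linearity, measurements and kernel forms. -/

section Density

variable {X : Type*} [MeasurableSpace X] {μ : Measure X}

/-- The integral of a bounded function against the signed measure of density `f` is the integral of
its product with `f`. -/
lemma vectorIntegral_withDensityᵥ {G : Type*} [NormedAddCommGroup G] [NormedSpace ℝ G]
    {f : X → ℝ} (hf : Integrable f μ) {g : X → G} (hg : StronglyMeasurable g) {C : ℝ}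
    (hC : ∀ x, ‖g x‖ ≤ C) :
    ∫ᵛ x, g x ∂<•(μ.withDensityᵥ f) = ∫ x, f x • g x ∂μ := by
  have h1 : IsFiniteMeasure (μ.withDensity fun x => ENNReal.ofReal (f x)) :=
    isFiniteMeasure_withDensity_ofReal hf.2
  have h2 : IsFiniteMeasure (μ.withDensity fun x => ENNReal.ofReal (-f x)) :=
    isFiniteMeasure_withDensity_ofReal hf.neg.2
  have hint : ∀ ν : Measure X, IsFiniteMeasure ν → Integrable g ν := fun ν _ =>
    Integrable.of_bound hg.aestronglyMeasurable C (Eventually.of_forall hC)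
  rw [withDensityᵥ_eq_withDensity_pos_part_sub_withDensity_neg_part hf,
    integral_sub_vectorMeasure, integral_toSignedMeasure, integral_toSignedMeasure,
    integral_withDensity_eq_integral_toReal_smul₀ hf.aemeasurable.ennreal_ofReal (by simp),
    integral_withDensity_eq_integral_toReal_smul₀
      (f := fun x => ENNReal.ofReal (-f x)) hf.neg.aemeasurable.ennreal_ofReal (by simp),
    ← MeasureTheory.integral_sub]
  · congr 1 with x
    rw [← sub_smul, ENNReal.toReal_ofReal', ENNReal.toReal_ofReal']
    congr 1
    rcases le_total 0 (f x) with h | h <;> simp [h]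
  · refine Integrable.smul_of_top_left (φ := fun x => (ENNReal.ofReal (f x)).toReal) ?_ ?_
    · simpa [ENNReal.toReal_ofReal'] using hf.pos_part
    · exact memLp_top_of_bound hg.aestronglyMeasurable C (Eventually.of_forall hC)
  · refine Integrable.smul_of_top_left (φ := fun x => (ENNReal.ofReal (-f x)).toReal) ?_ ?_
    · simpa [ENNReal.toReal_ofReal'] using hf.neg_part
    · exact memLp_top_of_bound hg.aestronglyMeasurable C (Eventually.of_forall hC)
  · simpa [VectorMeasure.Integrable] using hint _ h1
  · simpa [VectorMeasure.Integrable] using hint _ h2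

variable (μ) in
/-- The signed measure with density an element of `L¹`. -/
def density (f : X →₁[μ] ℝ) : SignedMeasure X := μ.withDensityᵥ f

lemma density_toL1 {f : X → ℝ} (hf : Integrable f μ) :
    density μ (hf.toL1 f) = μ.withDensityᵥ f :=
  WithDensityᵥEq.congr_ae hf.coeFn_toL1

lemma density_add (f g : X →₁[μ] ℝ) : density μ (f + g) = density μ f + density μ g := by
  rw [density, WithDensityᵥEq.congr_ae (Lp.coeFn_add f g),
    withDensityᵥ_add (L1.integrable_coeFn f) (L1.integrable_coeFn g)]
  rfl

lemma density_smul (c : ℝ) (f : X →₁[μ] ℝ) : density μ (c • f) = c • density μ f := by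
  rw [density, WithDensityᵥEq.congr_ae (Lp.coeFn_smul c f), withDensityᵥ_smul]
  rfl

lemma density_sub (f g : X →₁[μ] ℝ) : density μ (f - g) = density μ f - density μ g := by
  rw [density, WithDensityᵥEq.congr_ae (Lp.coeFn_sub f g),
    withDensityᵥ_sub (L1.integrable_coeFn f) (L1.integrable_coeFn g)]
  rfl

lemma density_zero : density μ (0 : X →₁[μ] ℝ) = 0 := by
  simpa using density_smul (μ := μ) 0 0

lemma density_sum {ι : Type*} (s : Finset ι) (f : ι → X →₁[μ] ℝ) :
    density μ (∑ i ∈ s, f i) = ∑ i ∈ s, density μ (f i) := by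
  classical
  induction s using Finset.induction_on with
  | empty => simp [density_zero]
  | insert a s ha ih => rw [Finset.sum_insert ha, Finset.sum_insert ha, density_add, ih]

variable (μ) in
/-- The integration of a bounded continuous function against densities in `L¹`. -/
def pairing [TopologicalSpace X] [OpensMeasurableSpace X] (α : X →ᵇ ℂ) :
    (X →₁[μ] ℝ) →L[ℝ] ℂ :=
  LinearMap.mkContinuous
    { toFun := fun f => ∫ x, (f x : ℝ) • α x ∂μ
      map_add' := fun f g => by
        have h : ∀ f : X →₁[μ] ℝ, Integrable (fun x => (f x : ℝ) • α x) μ := fun f =>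
          (L1.integrable_coeFn f).smul_of_top_left <|
            memLp_top_of_bound α.continuous.stronglyMeasurable.aestronglyMeasurable ‖α‖
              (Eventually.of_forall α.norm_coe_le_norm)
        rw [← integral_add (h f) (h g)]
        refine integral_congr_ae ?_
        filter_upwards [Lp.coeFn_add f g] with x hx
        rw [hx, Pi.add_apply, add_smul]
      map_smul' := fun c f => by
        rw [RingHom.id_apply, ← MeasureTheory.integral_smul]
        refine integral_congr_ae ?_
        filter_upwards [Lp.coeFn_smul c f] with x hx
        rw [hx, Pi.smul_apply, smul_assoc] }
    ‖α‖ fun f => by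
      rw [L1.norm_eq_integral_norm, ← integral_const_mul]
      refine norm_integral_le_of_norm_le ((L1.integrable_coeFn f).norm.const_mul _)
        (Eventually.of_forall fun x => ?_)
      rw [norm_smul, mul_comm]
      exact mul_le_mul_of_nonneg_right (α.norm_coe_le_norm x) (norm_nonneg _)

lemma integrable_kernel_mul [SFinite μ] {K : X → X → ℝ} (hK : Measurable (Function.uncurry K)) {c : ℝ}
    (hc : ∀ x y, |K x y| ≤ c) {f g : X → ℝ} (hf : Integrable f μ) (hg : Integrable g μ) :
    Integrable (fun z : X × X => K z.1 z.2 * (f z.1 * g z.2)) (μ.prod μ) :=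
  (hf.mul_prod hg).bdd_mul (c := c) hK.aestronglyMeasurable (Eventually.of_forall fun z => hc z.1 z.2)

lemma ae_prod_fst {P : X → Prop} (h : ∀ᵐ x ∂μ, P x) : ∀ᵐ z ∂(μ.prod μ), P z.1 :=
  Measure.quasiMeasurePreserving_fst.ae h

lemma ae_prod_snd {P : X → Prop} (h : ∀ᵐ x ∂μ, P x) : ∀ᵐ z ∂(μ.prod μ), P z.2 :=
  Measure.quasiMeasurePreserving_snd.ae h

variable [SFinite μ]

variable (μ) in
/-- The bilinear form of a bounded measurable kernel on densities in `L¹`. -/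
def kernelForm {K : X → X → ℝ} (hK : Measurable (Function.uncurry K)) {c : ℝ}
    (hc : ∀ x y, |K x y| ≤ c) : (X →₁[μ] ℝ) →L[ℝ] (X →₁[μ] ℝ) →L[ℝ] ℝ :=
  have hi := fun f g : X →₁[μ] ℝ =>
    integrable_kernel_mul hK hc (L1.integrable_coeFn f) (L1.integrable_coeFn g)
  LinearMap.mkContinuous₂
    (LinearMap.mk₂ ℝ
      (fun f g : X →₁[μ] ℝ => ∫ z : X × X, K z.1 z.2 * (f z.1 * g z.2) ∂(μ.prod μ))
      (fun f f' g => by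
        rw [← integral_add (hi f g) (hi f' g)]
        refine integral_congr_ae ?_
        filter_upwards [ae_prod_fst (Lp.coeFn_add f f')] with z hz
        rw [hz, Pi.add_apply]; ring)
      (fun r f g => by
        rw [← MeasureTheory.integral_smul]
        refine integral_congr_ae ?_
        filter_upwards [ae_prod_fst (Lp.coeFn_smul r f)] with z hz
        rw [hz, Pi.smul_apply, smul_eq_mul, smul_eq_mul]; ring)
      (fun f g g' => by
        rw [← integral_add (hi f g) (hi f g')]
        refine integral_congr_ae ?_
        filter_upwards [ae_prod_snd (Lp.coeFn_add g g')] with z hz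
        rw [hz, Pi.add_apply]; ring)
      (fun r f g => by
        rw [← MeasureTheory.integral_smul]
        refine integral_congr_ae ?_
        filter_upwards [ae_prod_snd (Lp.coeFn_smul r g)] with z hz
        rw [hz, Pi.smul_apply, smul_eq_mul, smul_eq_mul]; ring))
    c fun f g => by
      rw [LinearMap.mk₂_apply, L1.norm_eq_integral_norm, L1.norm_eq_integral_norm, mul_assoc,
        ← integral_prod_mul, ← integral_const_mul]
      refine norm_integral_le_of_norm_le
        (((L1.integrable_coeFn f).norm.mul_prod (L1.integrable_coeFn g).norm).const_mul _)
        (Eventually.of_forall fun z => ?_)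
      rw [norm_mul, norm_mul]
      exact mul_le_mul_of_nonneg_right (hc _ _) (by positivity)

lemma kernelForm_apply {K : X → X → ℝ} (hK : Measurable (Function.uncurry K)) {c : ℝ}
    (hc : ∀ x y, |K x y| ≤ c) (f g : X →₁[μ] ℝ) :
    kernelForm μ hK hc f g = ∫ z : X × X, K z.1 z.2 * (f z.1 * g z.2) ∂(μ.prod μ) := rfl

lemma kernelForm_toL1 {K : X → X → ℝ} (hK : Measurable (Function.uncurry K)) {c : ℝ}
    (hc : ∀ x y, |K x y| ≤ c) {f g : X → ℝ} (hf : Integrable f μ) (hg : Integrable g μ) :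
    kernelForm μ hK hc (hf.toL1 f) (hg.toL1 g)
      = ∫ z : X × X, K z.1 z.2 * (f z.1 * g z.2) ∂(μ.prod μ) := by
  rw [kernelForm_apply]
  refine integral_congr_ae ?_
  filter_upwards [ae_prod_fst hf.coeFn_toL1, ae_prod_snd hg.coeFn_toL1] with z h1 h2
  rw [h1, h2]

lemma kernelForm_comm {K : X → X → ℝ} (hK : Measurable (Function.uncurry K)) {c : ℝ}
    (hc : ∀ x y, |K x y| ≤ c) (hsymm : ∀ x y, K x y = K y x) (f g : X →₁[μ] ℝ) :
    kernelForm μ hK hc f g = kernelForm μ hK hc g f := by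
  rw [kernelForm_apply, kernelForm_apply, ← integral_prod_swap]
  congr 1 with z
  rw [hsymm, mul_comm (f _)]
  rfl

end Density

/-- Boundedness of the kernel makes Fubini applicable to the iterated integral. From here on the
kernel norm is the diagonal of a continuous bilinear form on $L^1$, so it can be expanded,
differentiated and passed to limits. -/
lemma kernelNormSq_density {p : ℕ} {K : Space p → Space p → ℝ}
    (hK : Measurable (Function.uncurry K)) {c : ℝ} (hc : ∀ x y, |K x y| ≤ c)
    (f : Space p →₁[volume] ℝ) :
    kernelNormSq K (density volume f) = kernelForm volume hK hc f f := by
  have hf := L1.integrable_coeFn f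
  have hin : ∀ t, ∫ᵛ s, K t s ∂<•(density volume f) = ∫ s, f s * K t s := fun t =>
    vectorIntegral_withDensityᵥ hf (hK.of_uncurry_left (x := t)).stronglyMeasurable (hc t)
  have hbd : ∀ t, ‖∫ s, f s * K t s‖ ≤ c * ∫ s, ‖f s‖ := fun t => by
    rw [← integral_const_mul]
    refine norm_integral_le_of_norm_le (hf.norm.const_mul _) (Eventually.of_forall fun s => ?_)
    rw [norm_mul, mul_comm]
    exact mul_le_mul_of_nonneg_right (hc t s) (norm_nonneg _)
  have hmeas : StronglyMeasurable fun t => ∫ s, f s * K t s := by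
    refine StronglyMeasurable.integral_prod_right' (f := fun z : Space p × Space p =>
      f z.2 * K z.1 z.2) ?_
    exact ((Lp.stronglyMeasurable f).comp_measurable measurable_snd).mul hK.stronglyMeasurable
  rw [kernelNormSq]
  simp_rw [hin]
  rw [density, vectorIntegral_withDensityᵥ hf hmeas hbd, kernelForm_apply,
    integral_prod _ (integrable_kernel_mul hK hc hf hf)]
  congr 1 with t
  rw [smul_eq_mul, ← integral_const_mul]
  congr 1 with s
  ring

/-- The measurement operator on densities in `L¹`. -/
def measureCLM {p m : ℕ} (α : Fin m → (Space p →ᵇ ℂ)) :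
    (Space p →₁[volume] ℝ) →L[ℝ] EuclideanSpace ℂ (Fin m) :=
  ((PiLp.continuousLinearEquiv 2 ℝ (fun _ : Fin m => ℂ)).symm :
    (Fin m → ℂ) →L[ℝ] EuclideanSpace ℂ (Fin m)).comp
    (ContinuousLinearMap.pi fun l => pairing volume (α l))

lemma measure_density {p m : ℕ} (α : Fin m → (Space p →ᵇ ℂ)) (f : Space p →₁[volume] ℝ) :
    measure α (density volume f) = measureCLM α f := by
  ext l
  exact vectorIntegral_withDensityᵥ (L1.integrable_coeFn f) (α l).continuous.stronglyMeasurable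
    (α l).norm_coe_le_norm

lemma norm_measureCLM_le {p m : ℕ} (α : Fin m → (Space p →ᵇ ℂ)) (f : Space p →₁[volume] ℝ) :
    ‖measureCLM α f‖ ≤ √(∑ l, ‖α l‖ ^ 2) * ‖f‖ := by
  rw [EuclideanSpace.norm_eq, ← Real.sqrt_sq (norm_nonneg f), ← Real.sqrt_mul (by positivity),
    Finset.sum_mul]
  refine Real.sqrt_le_sqrt (Finset.sum_le_sum fun l _ => ?_)
  rw [← mul_pow]
  refine pow_le_pow_left₀ (norm_nonneg _) ?_ 2
  exact (pairing volume (α l)).le_of_opNorm_le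
    (LinearMap.mkContinuous_norm_le _ (norm_nonneg _) _) f

/-! ### Calculus -/

section Calculus

variable {E F : Type*} [NormedAddCommGroup E] [NormedSpace ℝ E] [NormedAddCommGroup F]
  [NormedSpace ℝ F]

lemma norm_sub_le_of_norm_deriv_le {h h' : ℝ → E} {b : ℝ} (h1 : ∀ s, HasDerivAt h (h' s) s)
    (hb : ∀ s ∈ Set.Icc (0 : ℝ) 1, ‖h' s‖ ≤ b) {s : ℝ} (hs : s ∈ Set.Icc (0 : ℝ) 1) :
    ‖h s - h 0‖ ≤ b := by
  have hb0 : 0 ≤ b := (norm_nonneg _).trans (hb 0 (by simp))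
  have := norm_image_sub_le_of_norm_deriv_le_segment' (f := h) (f' := h') (C := b) (a := 0) (b := 1)
    (fun x _ => (h1 x).hasDerivWithinAt) (fun x hx => hb x ⟨hx.1, hx.2.le⟩) s hs
  refine this.trans ?_
  nlinarith [hs.1, hs.2]

/-- The mean value inequality applied twice. The sharp constant $b/2$ is not needed. -/
lemma norm_taylor_le {h h' h'' : ℝ → E} {b : ℝ} (h1 : ∀ s, HasDerivAt h (h' s) s)
    (h2 : ∀ s, HasDerivAt h' (h'' s) s) (hb : ∀ s ∈ Set.Icc (0 : ℝ) 1, ‖h'' s‖ ≤ b) :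
    ‖h 1 - h 0 - h' 0‖ ≤ b := by
  have key := norm_sub_le_of_norm_deriv_le (h := fun s => h s - s • h' 0)
    (h' := fun s => h' s - h' 0) (b := b)
    (fun s => by simpa [Function.comp_def] using (h1 s).fun_sub ((hasDerivAt_id s).smul_const (h' 0)))
    (fun s hs => norm_sub_le_of_norm_deriv_le h2 hb hs) (s := 1) (by simp)
  simpa [sub_right_comm] using key

/-- Meant for maps into $L^1$: a pointwise Taylor bound integrates to a quadratic remainder in norm.
-/
lemma hasFDerivAt_of_norm_le_sq {f : E → F} {f' : E →L[ℝ] F} {x : E} {C δ : ℝ} (hδ : 0 < δ)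
    (h : ∀ w, ‖w‖ ≤ δ → ‖f (x + w) - f x - f' w‖ ≤ C * ‖w‖ ^ 2) : HasFDerivAt f f' x := by
  rw [hasFDerivAt_iff_isLittleO_nhds_zero]
  have h1 : (fun w => f (x + w) - f x - f' w) =O[𝓝 0] fun w => ‖w‖ ^ 2 := by
    refine Asymptotics.IsBigO.of_bound C ?_
    filter_upwards [Metric.ball_mem_nhds (0 : E) hδ] with w hw
    have := h w (by simpa using (mem_ball_zero_iff.1 hw).le)
    simpa using this
  exact h1.trans_isLittleO (Asymptotics.isLittleO_norm_pow_id one_lt_two)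

lemma hasDerivAt_of_norm_le_sq {f : ℝ → F} {f' : F} {x : ℝ} {C δ : ℝ} (hδ : 0 < δ)
    (h : ∀ s, |s| ≤ δ → ‖f (x + s) - f x - s • f'‖ ≤ C * s ^ 2) : HasDerivAt f f' x := by
  rw [hasDerivAt_iff_hasFDerivAt]
  refine hasFDerivAt_of_norm_le_sq (C := C) hδ fun s hs => ?_
  simpa using h s hs

end Calculus

/-! ### The Mahalanobis norm -/

section Mahalanobis

variable {p : ℕ} {Γ : Matrix (Fin p) (Fin p) ℝ}

/-- Expand both sides in an orthonormal eigenbasis and compare coefficient by coefficient. -/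
lemma lambdaMin_mul_sq_le (hΓ : Γ.IsHermitian) (v : Space p) :
    lambdaMin hΓ * ‖v‖ ^ 2 ≤ inner ℝ v (WithLp.toLp 2 (Γ *ᵥ v.ofLp)) := by
  have hsymm : ∀ x y : Space p, inner ℝ x (WithLp.toLp 2 (Γ *ᵥ y.ofLp))
      = inner ℝ (WithLp.toLp 2 (Γ *ᵥ x.ofLp)) y := fun x y => by
    have := congrArg (fun M => M *ᵥ x.ofLp) hΓ.eq
    simp only [Matrix.conjTranspose_eq_transpose_of_trivial] at this
    rw [EuclideanSpace.inner_eq_star_dotProduct, EuclideanSpace.inner_eq_star_dotProduct]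
    simp only [star_trivial]
    rw [← this, Matrix.mulVec_transpose, dotProduct_comm, Matrix.dotProduct_mulVec, dotProduct_comm]
  have hb : ∀ i, inner ℝ (hΓ.eigenvectorBasis i) (WithLp.toLp 2 (Γ *ᵥ v.ofLp))
      = hΓ.eigenvalues i * inner ℝ (hΓ.eigenvectorBasis i) v := fun i => by
    rw [hsymm, hΓ.mulVec_eigenvectorBasis, WithLp.toLp_smul, inner_smul_left]
    rfl
  rw [← real_inner_self_eq_norm_sq, ← hΓ.eigenvectorBasis.sum_inner_mul_inner,
    ← hΓ.eigenvectorBasis.sum_inner_mul_inner v (WithLp.toLp 2 (Γ *ᵥ v.ofLp)), Finset.mul_sum]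
  refine Finset.sum_le_sum fun i _ => ?_
  rw [hb, real_inner_comm]
  have : lambdaMin hΓ ≤ hΓ.eigenvalues i := ciInf_le (Set.finite_range _).bddBelow i
  nlinarith [mul_self_nonneg (inner ℝ (hΓ.eigenvectorBasis i) v)]

lemma lambdaMin_pos [NeZero p] (hΓ : Γ.PosDef) : 0 < lambdaMin hΓ.isHermitian := by
  obtain ⟨i, hi⟩ := exists_eq_ciInf_of_finite (f := hΓ.isHermitian.eigenvalues)
  rw [lambdaMin, ← hi]
  exact hΓ.eigenvalues_pos i

lemma precMul_add (u v : Space p) : precMul Γ (u + v) = precMul Γ u + precMul Γ v := by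
  simp [precMul, Matrix.mulVec_add]

lemma precMul_smul (c : ℝ) (u : Space p) : precMul Γ (c • u) = c • precMul Γ u := by
  simp [precMul, Matrix.mulVec_smul]

lemma precMul_sub (u v : Space p) : precMul Γ (u - v) = precMul Γ u - precMul Γ v := by
  simp [precMul, Matrix.mulVec_sub]

variable (Γ) in
/-- The multiplication by `Γ⁻¹` as a continuous linear map. -/
def precCLM : Space p →L[ℝ] Space p :=
  LinearMap.toContinuousLinearMap
    { toFun := precMul Γ, map_add' := precMul_add, map_smul' := precMul_smul }

lemma continuous_precMul : Continuous (precMul Γ) := (precCLM Γ).continuous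

lemma continuous_mahalSq : Continuous (mahalSq Γ) :=
  continuous_id.inner continuous_precMul

lemma inner_precMul_comm (hΓ : Γ.PosDef) (u v : Space p) :
    inner ℝ u (precMul Γ v) = inner ℝ v (precMul Γ u) := by
  have h := hΓ.inv.isHermitian.eq
  rw [Matrix.conjTranspose_eq_transpose_of_trivial] at h
  rw [precMul, precMul, EuclideanSpace.inner_eq_star_dotProduct,
    EuclideanSpace.inner_eq_star_dotProduct]
  simp only [star_trivial]
  conv_lhs => rw [← h]
  rw [Matrix.mulVec_transpose, dotProduct_comm, dotProduct_comm (Γ⁻¹ *ᵥ u.ofLp),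
    Matrix.dotProduct_mulVec, dotProduct_comm]

lemma mahalSq_nonneg (hΓ : Γ.PosDef) (u : Space p) : 0 ≤ mahalSq Γ u := by
  have := hΓ.inv.posSemidef.dotProduct_mulVec_nonneg u.ofLp
  rw [mahalSq, precMul, EuclideanSpace.inner_eq_star_dotProduct]
  simpa [dotProduct_comm] using this

lemma mahalSq_add (hΓ : Γ.PosDef) (u v : Space p) :
    mahalSq Γ (u + v) = mahalSq Γ u + 2 * inner ℝ u (precMul Γ v) + mahalSq Γ v := by
  rw [mahalSq, precMul_add, inner_add_left, inner_add_right, inner_add_right,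
    inner_precMul_comm hΓ v u, mahalSq, mahalSq]
  ring

lemma mahalSq_smul (c : ℝ) (u : Space p) : mahalSq Γ (c • u) = c ^ 2 * mahalSq Γ u := by
  rw [mahalSq, precMul_smul, inner_smul_left, inner_smul_right, mahalSq]
  simp; ring

lemma mahalSq_neg (u : Space p) : mahalSq Γ (-u) = mahalSq Γ u := by
  simpa using mahalSq_smul (Γ := Γ) (-1) u

/-- The parallelogram identity with one nonnegative term dropped. -/
lemma mahalSq_sub_le (hΓ : Γ.PosDef) (u v : Space p) :
    mahalSq Γ (u - v) ≤ 2 * mahalSq Γ u + 2 * mahalSq Γ v := by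
  have h1 := mahalSq_add hΓ u v
  have h2 := mahalSq_add hΓ u (-v)
  have h3 := mahalSq_nonneg hΓ (u + v)
  have h4 : precMul Γ (-v) = - precMul Γ v := by simpa using precMul_smul (Γ := Γ) (-1) v
  rw [← sub_eq_add_neg, mahalSq_neg, h4, inner_neg_right] at h2
  linarith

lemma exists_pos_mul_sq_le_mahalSq [NeZero p] (hΓ : Γ.PosDef) :
    ∃ δ, 0 < δ ∧ ∀ u : Space p, δ * ‖u‖ ^ 2 ≤ mahalSq Γ u :=
  ⟨lambdaMin hΓ.inv.isHermitian, lambdaMin_pos hΓ.inv,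
    fun u => lambdaMin_mul_sq_le hΓ.inv.isHermitian u⟩

/-- No comparison of the spectra of $\Gamma$ and $\Gamma^{-1}$ is needed. With $w=\Gamma^{-1}u$, one
has $\lambda\|w\|^2\le\langle u,w\rangle\le\|u\|\|w\|$, hence $\lambda\|w\|\le\|u\|$, and so
$\lambda\langle u,w\rangle\le\|u\|^2$. -/
lemma mahalSq_le [NeZero p] (hΓ : Γ.PosDef) (u : Space p) :
    mahalSq Γ u ≤ 1 / lambdaMin hΓ.isHermitian * ‖u‖ ^ 2 := by
  have hpos := lambdaMin_pos hΓ
  have hu : WithLp.toLp 2 (Γ *ᵥ (precMul Γ u).ofLp) = u := by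
    have : IsUnit Γ.det := (Matrix.isUnit_iff_isUnit_det Γ).1 hΓ.isUnit
    simp [precMul, Matrix.mul_nonsing_inv Γ this]
  have h1 := lambdaMin_mul_sq_le hΓ.isHermitian (precMul Γ u)
  rw [hu, real_inner_comm] at h1
  have h2 : mahalSq Γ u ≤ ‖u‖ * ‖precMul Γ u‖ := real_inner_le_norm _ _
  change _ ≤ mahalSq Γ u at h1
  rw [one_div, inv_mul_eq_div, le_div_iff₀ hpos]
  have h3 := norm_nonneg u
  have h4 := norm_nonneg (precMul Γ u)
  rcases h4.eq_or_lt with h | h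
  · rw [← h] at h2
    nlinarith
  · have : lambdaMin hΓ.isHermitian * ‖precMul Γ u‖ ≤ ‖u‖ := by nlinarith
    nlinarith

end Mahalanobis

/-! ### Derivatives of the Gaussian density with respect to its mean -/

section Gaussian

variable {p : ℕ} {Γ : Matrix (Fin p) (Fin p) ℝ}

variable (Γ) in
/-- The first derivative of the density of `μ_t` with respect to `t` in the direction `w`. -/
def gaussianDeriv₁ (w t x : Space p) : ℝ :=
  inner ℝ w (precMul Γ (x - t)) * gaussianDensity Γ t x

variable (Γ) in
/-- The second derivative of the density of `μ_t` with respect to `t` in the direction `w`. -/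
def gaussianDeriv₂ (w t x : Space p) : ℝ :=
  (inner ℝ w (precMul Γ (x - t)) ^ 2 - mahalSq Γ w) * gaussianDensity Γ t x

variable (Γ) in
/-- The third derivative of the density of `μ_t` with respect to `t` in the direction `w`. -/
def gaussianDeriv₃ (w t x : Space p) : ℝ :=
  (inner ℝ w (precMul Γ (x - t)) ^ 3 - 3 * mahalSq Γ w * inner ℝ w (precMul Γ (x - t))) *
    gaussianDensity Γ t x

lemma hasDerivAt_inner_precMul (w t x : Space p) (s : ℝ) :
    HasDerivAt (fun s : ℝ => inner ℝ w (precMul Γ (x - (t + s • w)))) (-mahalSq Γ w) s := by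
  have h : ∀ s : ℝ, inner ℝ w (precMul Γ (x - (t + s • w)))
      = inner ℝ w (precMul Γ (x - t)) - s * mahalSq Γ w := fun s => by
    rw [← sub_sub, precMul_sub, inner_sub_right, precMul_smul, inner_smul_right, mahalSq]
  simp_rw [h]
  simpa using ((hasDerivAt_id s).mul_const (mahalSq Γ w)).const_sub (inner ℝ w (precMul Γ (x - t)))

lemma hasDerivAt_gaussianDensity (hΓ : Γ.PosDef) (w t x : Space p) (s : ℝ) :
    HasDerivAt (fun s : ℝ => gaussianDensity Γ (t + s • w) x) (gaussianDeriv₁ Γ w (t + s • w) x)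
      s := by
  have h : ∀ s : ℝ, mahalSq Γ (x - (t + s • w))
      = mahalSq Γ (x - t) - 2 * s * inner ℝ w (precMul Γ (x - t)) + s ^ 2 * mahalSq Γ w :=
    fun s => by
      have h1 := mahalSq_add hΓ (x - t) ((-s) • w)
      rw [precMul_smul, inner_smul_right, inner_precMul_comm hΓ, mahalSq_smul] at h1
      have h2 : x - (t + s • w) = (x - t) + (-s) • w := by rw [neg_smul]; abel
      rw [h2, h1]
      ring
  have h2 : HasDerivAt (fun s : ℝ => -(1 / 2) * mahalSq Γ (x - (t + s • w)))
      (inner ℝ w (precMul Γ (x - (t + s • w)))) s := by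
    have h3 : inner ℝ w (precMul Γ (x - (t + s • w)))
        = inner ℝ w (precMul Γ (x - t)) - s * mahalSq Γ w := by
      rw [← sub_sub, precMul_sub, inner_sub_right, precMul_smul, inner_smul_right, mahalSq]
    simp_rw [h, h3]
    have := (((((hasDerivAt_id s).const_mul 2).mul_const
      (inner ℝ w (precMul Γ (x - t)))).const_sub (mahalSq Γ (x - t))).add
      ((hasDerivAt_pow 2 s).mul_const (mahalSq Γ w))).const_mul (-(1 / 2) : ℝ)
    refine this.congr_deriv ?_
    simp; ring
  rw [gaussianDeriv₁, mul_comm]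
  exact h2.exp

lemma hasDerivAt_gaussianDeriv₁ (hΓ : Γ.PosDef) (w t x : Space p) (s : ℝ) :
    HasDerivAt (fun s : ℝ => gaussianDeriv₁ Γ w (t + s • w) x) (gaussianDeriv₂ Γ w (t + s • w) x)
      s := by
  refine ((hasDerivAt_inner_precMul w t x s).mul
    (hasDerivAt_gaussianDensity hΓ w t x s)).congr_deriv ?_
  rw [gaussianDeriv₁, gaussianDeriv₂]
  ring

lemma hasDerivAt_gaussianDeriv₂ (hΓ : Γ.PosDef) (w t x : Space p) (s : ℝ) :
    HasDerivAt (fun s : ℝ => gaussianDeriv₂ Γ w (t + s • w) x) (gaussianDeriv₃ Γ w (t + s • w) x)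
      s := by
  refine ((((hasDerivAt_inner_precMul w t x s).pow 2).sub_const (mahalSq Γ w)).mul
    (hasDerivAt_gaussianDensity hΓ w t x s)).congr_deriv ?_
  rw [gaussianDeriv₁, gaussianDeriv₃]
  simp only [Pi.pow_apply, Nat.cast_ofNat]
  ring

lemma continuous_gaussianDensity (t : Space p) : Continuous (gaussianDensity Γ t) := by
  have := continuous_mahalSq (Γ := Γ)
  unfold gaussianDensity
  fun_prop

lemma continuous_gaussianDeriv₁ (w t : Space p) : Continuous (gaussianDeriv₁ Γ w t) := by
  have := continuous_precMul (Γ := Γ)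
  have := continuous_gaussianDensity (Γ := Γ) t
  unfold gaussianDeriv₁
  fun_prop

lemma continuous_gaussianDeriv₂ (w t : Space p) : Continuous (gaussianDeriv₂ Γ w t) := by
  have := continuous_precMul (Γ := Γ)
  have := continuous_gaussianDensity (Γ := Γ) t
  unfold gaussianDeriv₂
  fun_prop

/-- A common integrable majorant of the Gaussian densities with means in the unit ball and of their
derivatives. -/
lemma exists_majorant [NeZero p] (hΓ : Γ.PosDef) :
    ∃ N : Space p → ℝ, Integrable N ∧ ∀ w t z x : Space p, ‖z‖ ≤ 1 →
      |gaussianDensity Γ (t + z) x| ≤ N (x - t) ∧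
      |gaussianDeriv₁ Γ w (t + z) x| ≤ ‖w‖ * N (x - t) ∧
      |gaussianDeriv₂ Γ w (t + z) x| ≤ ‖w‖ ^ 2 * N (x - t) ∧
      |gaussianDeriv₃ Γ w (t + z) x| ≤ ‖w‖ ^ 3 * N (x - t) := by
  obtain ⟨δ, hδ, hlow⟩ := exists_pos_mul_sq_le_mahalSq hΓ
  set L := ‖precCLM Γ‖ + 1 with hL
  have hL1 : 1 ≤ L := by simp [hL]
  -- The Gaussian factor decays like $e^{-\delta\|u\|^2/4}$. Squaring $(1+\|u\|)^2\lesssim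
  -- e^{\eta\|u\|^2}$ with $\eta=\delta/16$ costs $e^{\delta\|u\|^2/8}$ and leaves the rate
  -- $\delta/8$. The factor $4L^3$ covers the worst polynomial, $L^3a^3+3L^2a$ with $a=1+\|u\|$,
  -- from the third derivative.
  set η := δ / 16 with hη
  have hη0 : 0 < η := by positivity
  set C := 4 * L ^ 3 * (2 * max 1 (1 / η)) ^ 2 * Real.exp (δ / 2) with hC
  refine ⟨fun x => C * Real.exp (-(δ / 8) * ‖x‖ ^ 2), ?_, ?_⟩
  · refine Integrable.const_mul ?_ _
    have h := (GaussianFourier.integrable_cexp_neg_mul_sq_norm_add (V := Space p)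
      (b := ((δ / 8 : ℝ) : ℂ)) (by simpa using hδ) 0 0).norm
    refine h.congr (Eventually.of_forall fun x => ?_)
    simp only [Complex.norm_exp]
    congr 1
    simp [← Complex.ofReal_pow]
  intro w t z x hz
  set u := x - t with hu
  have hxz : x - (t + z) = u - z := by rw [hu]; abel
  have hy := norm_nonneg u
  have hz0 := norm_nonneg z
  have hw := norm_nonneg w
  -- the Gaussian factor
  have hnorm : ‖u‖ ^ 2 ≤ 2 * ‖u - z‖ ^ 2 + 2 := by
    have : ‖u‖ ≤ ‖u - z‖ + ‖z‖ := by simpa using norm_add_le (u - z) z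
    nlinarith [norm_nonneg (u - z), sq_nonneg (‖u - z‖ - ‖z‖)]
  have hg : gaussianDensity Γ (t + z) x ≤ Real.exp (δ / 2) * Real.exp (-(δ / 4) * ‖u‖ ^ 2) := by
    rw [gaussianDensity, ← Real.exp_add, Real.exp_le_exp, hxz]
    have := hlow (u - z)
    nlinarith
  have hg0 : 0 ≤ gaussianDensity Γ (t + z) x := (Real.exp_pos _).le
  -- polynomial growth is absorbed
  have hpoly : (1 + ‖u‖) ^ 4 ≤ (2 * max 1 (1 / η)) ^ 2 * Real.exp (δ / 8 * ‖u‖ ^ 2) := by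
    have h1 : (1 + ‖u‖) ^ 2 ≤ 2 * max 1 (1 / η) * Real.exp (η * ‖u‖ ^ 2) := by
      have h2 := Real.add_one_le_exp (η * ‖u‖ ^ 2)
      have h3 : (1 + ‖u‖ ^ 2) ≤ max 1 (1 / η) * (η * ‖u‖ ^ 2 + 1) := by
        have h4 : 1 ≤ max 1 (1 / η) * η := by
          have := mul_le_mul_of_nonneg_right (le_max_right 1 (1 / η)) hη0.le
          rwa [one_div_mul_cancel hη0.ne'] at this
        nlinarith [le_max_left 1 (1 / η), sq_nonneg ‖u‖]
      have h5 : 0 ≤ max 1 (1 / η) := zero_le_one.trans (le_max_left _ _)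
      nlinarith [mul_le_mul_of_nonneg_left h2 h5, sq_nonneg (1 - ‖u‖)]
    calc (1 + ‖u‖) ^ 4 = ((1 + ‖u‖) ^ 2) ^ 2 := by ring
      _ ≤ (2 * max 1 (1 / η) * Real.exp (η * ‖u‖ ^ 2)) ^ 2 := by gcongr
      _ = _ := by
        rw [mul_pow, ← Real.exp_nat_mul]
        congr 2
        rw [hη]; push_cast; ring
  have hmain : 4 * L ^ 3 * (1 + ‖u‖) ^ 4 * gaussianDensity Γ (t + z) x
      ≤ C * Real.exp (-(δ / 8) * ‖u‖ ^ 2) := by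
    calc 4 * L ^ 3 * (1 + ‖u‖) ^ 4 * gaussianDensity Γ (t + z) x
        ≤ 4 * L ^ 3 * ((2 * max 1 (1 / η)) ^ 2 * Real.exp (δ / 8 * ‖u‖ ^ 2)) *
          (Real.exp (δ / 2) * Real.exp (-(δ / 4) * ‖u‖ ^ 2)) := by gcongr
      _ = C * (Real.exp (δ / 8 * ‖u‖ ^ 2) * Real.exp (-(δ / 4) * ‖u‖ ^ 2)) := by rw [hC]; ring
      _ = _ := by rw [← Real.exp_add]; congr 2; ring
  have hq0 := mahalSq_nonneg hΓ w
  have hP : ∀ v, ‖precMul Γ v‖ ≤ L * ‖v‖ := fun v =>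
    ((precCLM Γ).le_opNorm v).trans (by gcongr; simp [hL])
  have hq : mahalSq Γ w ≤ L * ‖w‖ ^ 2 := by
    have := real_inner_le_norm w (precMul Γ w)
    calc _ ≤ ‖w‖ * ‖precMul Γ w‖ := this
      _ ≤ ‖w‖ * (L * ‖w‖) := by gcongr; exact hP w
      _ = _ := by ring
  have hl : |inner ℝ w (precMul Γ (u - z))| ≤ ‖w‖ * (L * (1 + ‖u‖)) := by
    refine (abs_real_inner_le_norm _ _).trans ?_
    gcongr
    refine (hP _).trans ?_
    gcongr
    linarith [norm_sub_le u z]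
  set ℓ := inner ℝ w (precMul Γ (u - z)) with hℓ
  set a := 1 + ‖u‖ with ha
  have ha1 : 1 ≤ a := by simp [ha]
  set D := gaussianDensity Γ (t + z) x with hD
  have hL0 : 0 ≤ L := zero_le_one.trans hL1
  have ha0 : 0 ≤ a := zero_le_one.trans ha1
  have key : ∀ (n : ℕ) (c : ℝ), |c| ≤ ‖w‖ ^ n * (4 * L ^ 3 * a ^ 4) →
      |c * D| ≤ ‖w‖ ^ n * (C * Real.exp (-(δ / 8) * ‖u‖ ^ 2)) := fun n c hc => by
    rw [abs_mul, abs_of_nonneg hg0]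
    refine (mul_le_mul_of_nonneg_right hc hg0).trans ?_
    rw [mul_assoc]
    exact mul_le_mul_of_nonneg_left hmain (by positivity)
  have hLi : ∀ i ≤ 3, L ^ i ≤ L ^ 3 := fun i hi => pow_le_pow_right₀ hL1 hi
  have hai : ∀ i ≤ 4, a ^ i ≤ a ^ 4 := fun i hi => pow_le_pow_right₀ ha1 hi
  have hLa : ∀ i ≤ 3, ∀ j ≤ 4, L ^ i * a ^ j ≤ L ^ 3 * a ^ 4 := fun i hi j hj =>
    mul_le_mul (hLi i hi) (hai j hj) (by positivity) (by positivity)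
  have hLa0 : 0 ≤ L ^ 3 * a ^ 4 := by positivity
  refine ⟨?_, ?_, ?_, ?_⟩
  · have := key 0 1 (by
      have := hLa 0 (by norm_num) 0 (by norm_num)
      simp only [pow_zero, abs_one] at this ⊢
      linarith)
    simpa using this
  · have := key 1 ℓ (by
      have h1 := hLa 1 (by norm_num) 1 (by norm_num)
      rw [pow_one, pow_one] at h1
      refine hl.trans ?_
      rw [pow_one]
      exact mul_le_mul_of_nonneg_left (by linarith) hw)
    rw [gaussianDeriv₁, hxz]
    simpa using this
  · rw [gaussianDeriv₂, hxz]
    refine key 2 _ ?_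
    have h1 : |ℓ| ^ 2 ≤ (‖w‖ * (L * a)) ^ 2 := pow_le_pow_left₀ (abs_nonneg _) hl 2
    have h2 := hLa 2 (by norm_num) 2 (by norm_num)
    have h3 := hLa 1 (by norm_num) 0 (by norm_num)
    simp only [pow_one, pow_zero, mul_one] at h3
    calc |ℓ ^ 2 - mahalSq Γ w| ≤ |ℓ ^ 2| + |mahalSq Γ w| := abs_sub _ _
      _ ≤ (‖w‖ * (L * a)) ^ 2 + L * ‖w‖ ^ 2 := by
        rw [abs_pow, abs_of_nonneg hq0]; gcongr
      _ = ‖w‖ ^ 2 * (L ^ 2 * a ^ 2 + L) := by ring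
      _ ≤ _ := mul_le_mul_of_nonneg_left (by linarith) (by positivity)
  · rw [gaussianDeriv₃, hxz]
    refine key 3 _ ?_
    have h1 : |ℓ| ^ 3 ≤ (‖w‖ * (L * a)) ^ 3 := pow_le_pow_left₀ (abs_nonneg _) hl 3
    have h2 := hLa 3 (by norm_num) 3 (by norm_num)
    have h3 := hLa 2 (by norm_num) 1 (by norm_num)
    rw [pow_one] at h3
    calc |ℓ ^ 3 - 3 * mahalSq Γ w * ℓ| ≤ |ℓ ^ 3| + |3 * mahalSq Γ w * ℓ| := abs_sub _ _
      _ ≤ (‖w‖ * (L * a)) ^ 3 + 3 * (L * ‖w‖ ^ 2) * (‖w‖ * (L * a)) := by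
        rw [abs_pow, abs_mul, abs_mul, abs_of_nonneg hq0, abs_of_pos (by norm_num : (0 : ℝ) < 3)]
        gcongr
      _ = ‖w‖ ^ 3 * (L ^ 3 * a ^ 3 + 3 * (L ^ 2 * a)) := by ring
      _ ≤ _ := mul_le_mul_of_nonneg_left (by linarith) (by positivity)

end Gaussian

/-! ### The Gaussian densities in `L¹` -/

section GaussianL1

variable {p : ℕ} {Γ : Matrix (Fin p) (Fin p) ℝ}

lemma integrable_of_le_majorant {N f : Space p → ℝ} (hN : Integrable N) {t : Space p} {c : ℝ}
    (hf : Continuous f) (h : ∀ x, |f x| ≤ c * N (x - t)) : Integrable f :=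
  ((hN.comp_sub_right t).const_mul c).mono' hf.aestronglyMeasurable (Eventually.of_forall h)

lemma norm_toL1_le_majorant {N f : Space p → ℝ} (hN : Integrable N) {t : Space p} {c : ℝ}
    (hf : Integrable f) (h : ∀ x, |f x| ≤ c * N (x - t)) : ‖hf.toL1 f‖ ≤ c * ∫ x, N x := by
  rw [L1.norm_of_fun_eq_integral_norm, ← integral_sub_right_eq_self N t, ← integral_const_mul]
  exact integral_mono hf.norm ((hN.comp_sub_right t).const_mul c) h

variable [NeZero p]

lemma integrable_gaussianDensity (hΓ : Γ.PosDef) (t : Space p) :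
    Integrable (gaussianDensity Γ t) := by
  obtain ⟨N, hN, h⟩ := exists_majorant hΓ
  refine integrable_of_le_majorant (c := 1) (t := t) hN (continuous_gaussianDensity t) fun x => ?_
  simpa using (h 0 t 0 x (by simp)).1

lemma integrable_gaussianDeriv₁ (hΓ : Γ.PosDef) (w t : Space p) :
    Integrable (gaussianDeriv₁ Γ w t) := by
  obtain ⟨N, hN, h⟩ := exists_majorant hΓ
  refine integrable_of_le_majorant (c := ‖w‖) (t := t) hN (continuous_gaussianDeriv₁ w t)
    fun x => ?_
  simpa using (h w t 0 x (by simp)).2.1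

lemma integrable_gaussianDeriv₂ (hΓ : Γ.PosDef) (w t : Space p) :
    Integrable (gaussianDeriv₂ Γ w t) := by
  obtain ⟨N, hN, h⟩ := exists_majorant hΓ
  refine integrable_of_le_majorant (c := ‖w‖ ^ 2) (t := t) hN (continuous_gaussianDeriv₂ w t)
    fun x => ?_
  simpa using (h w t 0 x (by simp)).2.2.1

/-- The density of `μ_t` in `L¹`. -/
def gaussL1 (hΓ : Γ.PosDef) (t : Space p) : Space p →₁[volume] ℝ :=
  (integrable_gaussianDensity hΓ t).toL1 _

/-- The density of `∂_w μ_t` in `L¹`, as a linear function of `w`. -/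
def gaussL1Deriv (hΓ : Γ.PosDef) (t : Space p) : Space p →L[ℝ] (Space p →₁[volume] ℝ) :=
  LinearMap.toContinuousLinearMap
    { toFun := fun w => (integrable_gaussianDeriv₁ hΓ w t).toL1 _
      map_add' := fun w w' => by
        rw [← Integrable.toL1_add]
        congr 1
        ext x
        simp only [gaussianDeriv₁, inner_add_left, Pi.add_apply]
        ring
      map_smul' := fun c w => by
        rw [RingHom.id_apply, ← Integrable.toL1_smul]
        congr 1
        ext x
        simp only [gaussianDeriv₁, inner_smul_left, smul_eq_mul, conj_trivial]
        ring }

/-- The second derivative of the density of `μ_t` in the direction `w`, in `L¹`. -/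
def gaussL1Deriv₂ (hΓ : Γ.PosDef) (w t : Space p) : Space p →₁[volume] ℝ :=
  (integrable_gaussianDeriv₂ hΓ w t).toL1 _

lemma gaussL1Deriv_apply (hΓ : Γ.PosDef) (t w : Space p) :
    gaussL1Deriv hΓ t w = (integrable_gaussianDeriv₁ hΓ w t).toL1 _ := rfl

lemma density_gaussL1 (hΓ : Γ.PosDef) (t : Space p) :
    density volume (gaussL1 hΓ t) = gaussian Γ t := density_toL1 _

lemma density_gaussL1Deriv (hΓ : Γ.PosDef) (t w : Space p) :
    density volume (gaussL1Deriv hΓ t w) = dGaussian Γ w t :=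
  density_toL1 (integrable_gaussianDeriv₁ hΓ w t)

lemma exists_norm_gaussL1_le (hΓ : Γ.PosDef) :
    ∃ C, 0 ≤ C ∧ ∀ t w, ‖gaussL1 hΓ t‖ ≤ C ∧ ‖gaussL1Deriv hΓ t w‖ ≤ C * ‖w‖ := by
  obtain ⟨N, hN, h⟩ := exists_majorant hΓ
  have h0 : ∀ t, ‖gaussL1 hΓ t‖ ≤ ∫ x, N x := fun t => by
    have := norm_toL1_le_majorant (c := 1) (t := t) hN (integrable_gaussianDensity hΓ t)
      fun x => by simpa using (h 0 t 0 x (by simp)).1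
    rwa [one_mul] at this
  refine ⟨∫ x, N x, (norm_nonneg _).trans (h0 0), fun t w => ⟨h0 t, ?_⟩⟩
  rw [mul_comm]
  exact norm_toL1_le_majorant (c := ‖w‖) (t := t) hN (integrable_gaussianDeriv₁ hΓ w t)
      fun x => by simpa using (h w t 0 x (by simp)).2.1

/-- At each $x$ the Taylor remainder is at most $\|w\|^2N(x-t)$, with a majorant $N$ uniform over
means at distance at most $1$ from $t$. Integrating in $x$ gives differentiability in $L^1$. -/
lemma hasFDerivAt_gaussL1 (hΓ : Γ.PosDef) (t : Space p) :
    HasFDerivAt (gaussL1 hΓ) (gaussL1Deriv hΓ t) t := by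
  obtain ⟨N, hN, h⟩ := exists_majorant hΓ
  refine hasFDerivAt_of_norm_le_sq (C := ∫ x, N x) one_pos fun w hw => ?_
  rw [gaussL1Deriv_apply, gaussL1, gaussL1, ← Integrable.toL1_sub, ← Integrable.toL1_sub, mul_comm]
  refine norm_toL1_le_majorant (t := t) hN _ fun x => ?_
  have key := norm_taylor_le (hasDerivAt_gaussianDensity hΓ w t x)
    (hasDerivAt_gaussianDeriv₁ hΓ w t x) (b := ‖w‖ ^ 2 * N (x - t)) fun s hs => by
      refine (h w t (s • w) x ?_).2.2.1
      rw [norm_smul, Real.norm_of_nonneg hs.1]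
      exact mul_le_one₀ hs.2 (norm_nonneg _) hw
  simpa using key

lemma hasDerivAt_gaussL1 (hΓ : Γ.PosDef) (t w : Space p) (s : ℝ) :
    HasDerivAt (fun s : ℝ => gaussL1 hΓ (t + s • w)) (gaussL1Deriv hΓ (t + s • w) w) s := by
  have h1 : HasDerivAt (fun s : ℝ => t + s • w) w s := by
    simpa using ((hasDerivAt_id s).smul_const w).const_add t
  exact (hasFDerivAt_gaussL1 hΓ (t + s • w)).comp_hasDerivAt s h1

/-- The same argument one order higher, with the third derivative controlling the remainder. The
increment $r$ is rescaled to the unit interval by $u\mapsto s+ur$, and $\delta=(1+\|w\|)^{-1}$ keeps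
$\|urw\|\le1$, the range of the majorant. -/
lemma hasDerivAt_gaussL1Deriv (hΓ : Γ.PosDef) (t w : Space p) (s : ℝ) :
    HasDerivAt (fun s : ℝ => gaussL1Deriv hΓ (t + s • w) w) (gaussL1Deriv₂ hΓ w (t + s • w)) s := by
  obtain ⟨N, hN, h⟩ := exists_majorant hΓ
  refine hasDerivAt_of_norm_le_sq (C := ‖w‖ ^ 3 * ∫ x, N x) (δ := (1 + ‖w‖)⁻¹) (by positivity)
    fun r hr => ?_
  rw [gaussL1Deriv_apply, gaussL1Deriv_apply, gaussL1Deriv₂, ← Integrable.toL1_sub,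
    ← Integrable.toL1_smul, ← Integrable.toL1_sub]
  refine (norm_toL1_le_majorant (t := t + s • w) (c := r ^ 2 * ‖w‖ ^ 3) hN _ fun x => ?_).trans_eq
    (by ring)
  have e : ∀ u : ℝ, t + (s + u * r) • w = t + s • w + (u * r) • w := fun u => by
    rw [add_smul, add_assoc]
  have hl : ∀ u : ℝ, HasDerivAt (fun u : ℝ => s + u * r) r u := fun u => by
    simpa using ((hasDerivAt_id u).mul_const r).const_add s
  have h1 : ∀ u : ℝ, HasDerivAt (fun u : ℝ => gaussianDeriv₁ Γ w (t + (s + u * r) • w) x)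
      (r * gaussianDeriv₂ Γ w (t + (s + u * r) • w) x) u := fun u => by
    simpa [mul_comm, Function.comp_def] using
      (hasDerivAt_gaussianDeriv₁ hΓ w t x (s + u * r)).comp u (hl u)
  have h2 : ∀ u : ℝ, HasDerivAt (fun u : ℝ => r * gaussianDeriv₂ Γ w (t + (s + u * r) • w) x)
      (r ^ 2 * gaussianDeriv₃ Γ w (t + (s + u * r) • w) x) u := fun u => by
    rw [pow_two, mul_assoc]
    refine HasDerivAt.const_mul r ?_
    simpa [mul_comm, Function.comp_def] using
      (hasDerivAt_gaussianDeriv₂ hΓ w t x (s + u * r)).comp u (hl u)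
  have key := norm_taylor_le h1 h2 (b := r ^ 2 * ‖w‖ ^ 3 * N (x - (t + s • w))) fun u hu => by
      have h3 := (h w (t + s • w) ((u * r) • w) x ?_).2.2.2
      · rw [← e] at h3
        rw [Real.norm_eq_abs, abs_mul, abs_of_nonneg (sq_nonneg r), mul_assoc]
        exact mul_le_mul_of_nonneg_left h3 (sq_nonneg r)
      · rw [norm_smul, norm_mul, Real.norm_of_nonneg hu.1, Real.norm_eq_abs]
        have h4 : |r| * ‖w‖ ≤ 1 := by
          calc |r| * ‖w‖ ≤ (1 + ‖w‖)⁻¹ * (1 + ‖w‖) := by gcongr; linarith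
            _ = 1 := inv_mul_cancel₀ (by positivity)
        nlinarith [hu.1, hu.2, mul_nonneg (abs_nonneg r) (norm_nonneg w)]
  simpa using key

/-- The total mass does not depend on the mean, hence the second derivatives have mass zero. -/
lemma integral_gaussianDeriv₂ (hΓ : Γ.PosDef) (w t : Space p) :
    ∫ x, gaussianDeriv₂ Γ w t x = 0 := by
  have h0 : ∀ t, L1.integralCLM (gaussL1 hΓ t) = ∫ x, gaussianDensity Γ 0 x := fun t => by
    rw [← L1.integral_eq, gaussL1, ← MeasureTheory.integral_eq,
      ← integral_sub_right_eq_self (gaussianDensity Γ 0) t]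
    simp only [gaussianDensity, sub_zero]
  have h1 : ∀ t, L1.integralCLM (gaussL1Deriv hΓ t w) = 0 := fun t => by
    have := L1.integralCLM.hasFDerivAt.comp_hasDerivAt 0 (hasDerivAt_gaussL1 hΓ t w 0)
    rw [zero_smul, add_zero] at this
    refine this.unique ?_
    simp only [Function.comp_def, h0]
    exact hasDerivAt_const _ _
  have h2 : L1.integralCLM (gaussL1Deriv₂ hΓ w t) = 0 := by
    have := L1.integralCLM.hasFDerivAt.comp_hasDerivAt 0 (hasDerivAt_gaussL1Deriv hΓ t w 0)
    rw [zero_smul, add_zero] at this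
    refine this.unique ?_
    simp only [Function.comp_def, h1]
    exact hasDerivAt_const _ _
  rwa [← L1.integral_eq, gaussL1Deriv₂, ← MeasureTheory.integral_eq] at h2

/-- With $\ell=\langle w,\Gamma^{-1}(x-t)\rangle$ and $q=\|w\|_\Gamma^2$, use
$|\ell^2-q|\le(\ell^2-q)+2q$. The first summand, weighted by the Gaussian, integrates to zero. -/
lemma norm_gaussL1Deriv₂_le (hΓ : Γ.PosDef) (w t : Space p) :
    ‖gaussL1Deriv₂ hΓ w t‖ ≤ 2 * mahalSq Γ w * ∫ x, gaussianDensity Γ 0 x := by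
  have h0 : ∫ x, gaussianDensity Γ 0 x = ∫ x, gaussianDensity Γ t x := by
    rw [← integral_sub_right_eq_self (gaussianDensity Γ 0) t]
    simp only [gaussianDensity, sub_zero]
  rw [gaussL1Deriv₂, L1.norm_of_fun_eq_integral_norm, h0, ← integral_const_mul,
    ← zero_add (∫ x, _ * _), ← integral_gaussianDeriv₂ hΓ w t,
    ← integral_add (integrable_gaussianDeriv₂ hΓ w t)
      ((integrable_gaussianDensity hΓ t).const_mul _)]
  refine integral_mono (integrable_gaussianDeriv₂ hΓ w t).norm
    ((integrable_gaussianDeriv₂ hΓ w t).add ((integrable_gaussianDensity hΓ t).const_mul _))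
    fun x => ?_
  have hg : 0 ≤ gaussianDensity Γ t x := (Real.exp_pos _).le
  have hq := mahalSq_nonneg hΓ w
  simp only [gaussianDeriv₂, Real.norm_eq_abs, abs_mul, abs_of_nonneg hg]
  rw [← add_mul]
  refine mul_le_mul_of_nonneg_right (abs_le.2 ⟨?_, ?_⟩) hg <;>
    nlinarith [sq_nonneg (inner ℝ w (precMul Γ (x - t)))]

end GaussianL1

/-! ### The Gaussian kernel -/

section Kernel

variable {p : ℕ} {Γ : Matrix (Fin p) (Fin p) ℝ} {c r : ℝ}

lemma measurable_gaussianKernel : Measurable (Function.uncurry (gaussianKernel Γ c r)) := by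
  have := continuous_mahalSq (Γ := Γ)
  refine Continuous.measurable ?_
  unfold gaussianKernel Function.uncurry
  fun_prop

lemma gaussianKernel_nonneg (hc : 0 < c) (x y : Space p) : 0 ≤ gaussianKernel Γ c r x y :=
  mul_nonneg hc.le (Real.exp_pos _).le

lemma abs_gaussianKernel_le (hΓ : Γ.PosDef) (hc : 0 < c) (hr : 0 < r) (x y : Space p) :
    |gaussianKernel Γ c r x y| ≤ c := by
  rw [abs_of_nonneg (gaussianKernel_nonneg hc x y), gaussianKernel]
  refine mul_le_of_le_one_right hc.le (Real.exp_le_one_iff.2 ?_)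
  rw [neg_mul]
  exact neg_nonpos.2 (mul_nonneg (by positivity) (mahalSq_nonneg hΓ _))

/-- The bilinear form of the Gaussian kernel on densities in `L¹`. -/
def gaussForm (hΓ : Γ.PosDef) (hc : 0 < c) (hr : 0 < r) :
    (Space p →₁[volume] ℝ) →L[ℝ] (Space p →₁[volume] ℝ) →L[ℝ] ℝ :=
  kernelForm volume measurable_gaussianKernel (abs_gaussianKernel_le hΓ hc hr)

lemma gaussForm_comm (hΓ : Γ.PosDef) (hc : 0 < c) (hr : 0 < r) (f g : Space p →₁[volume] ℝ) :
    gaussForm hΓ hc hr f g = gaussForm hΓ hc hr g f := by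
  refine kernelForm_comm _ _ (fun x y => ?_) f g
  rw [gaussianKernel, gaussianKernel, ← mahalSq_neg, neg_sub]

lemma kernelNormSq_eq_gaussForm (hΓ : Γ.PosDef) (hc : 0 < c) (hr : 0 < r)
    (f : Space p →₁[volume] ℝ) :
    kernelNormSq (gaussianKernel Γ c r) (density volume f) = gaussForm hΓ hc hr f f :=
  kernelNormSq_density _ _ f

variable [NeZero p]

/-- The kernel inner product of two Gaussian measures, by completing the square. -/
lemma gaussForm_gaussL1 (hΓ : Γ.PosDef) (hc : 0 < c) (hr : 0 < r) (t s : Space p) :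
    gaussForm hΓ hc hr (gaussL1 hΓ t) (gaussL1 hΓ s)
      = Real.exp (-(1 / (2 * (r + 2))) * mahalSq Γ (t - s)) *
        gaussForm hΓ hc hr (gaussL1 hΓ 0) (gaussL1 hΓ 0) := by
  -- The total exponent $\|x-y\|_\Gamma^2/r+\|x-t\|_\Gamma^2+\|y-s\|_\Gamma^2$ is stationary at
  -- $x=t-\lambda d$, $y=s+\lambda d$ exactly when $(1-2\lambda)/r=\lambda$. Translating to this
  -- point removes all cross terms.
  set lam := 1 / (r + 2) with hlam
  set d := t - s with hd
  rw [gaussForm, gaussL1, gaussL1, gaussL1, kernelForm_toL1, kernelForm_toL1,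
    ← integral_const_mul, ← integral_add_right_eq_self _ (t + (-lam) • d, s + lam • d)]
  congr 1 with ⟨x, y⟩
  have hrl : r * lam = 1 - 2 * lam := by rw [hlam]; field_simp; ring
  have e1 : x + (t + (-lam) • d) - (y + (s + lam • d)) = (x - y) + (r * lam) • d := by
    rw [hrl, sub_smul, mul_smul, two_smul, one_smul, neg_smul, hd]; abel
  have e2 : x + (t + (-lam) • d) - t = x + (-lam) • d := by abel
  have e3 : y + (s + lam • d) - s = y + lam • d := by abel
  have q : ∀ (u : Space p) (a : ℝ), mahalSq Γ (u + a • d)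
      = mahalSq Γ u + 2 * a * inner ℝ u (precMul Γ d) + a ^ 2 * mahalSq Γ d := fun u a => by
    rw [mahalSq_add hΓ, precMul_smul, inner_smul_right, mahalSq_smul]; ring
  simp only [gaussianKernel, gaussianDensity, Prod.mk_add_mk, e1, e2, e3, q, sub_zero,
    inner_sub_left]
  have : ∀ a b e a' b' e' f : ℝ, a + (b + e) = f + (a' + (b' + e')) →
      c * Real.exp a * (Real.exp b * Real.exp e)
        = Real.exp f * (c * Real.exp a' * (Real.exp b' * Real.exp e')) :=
    fun a b e a' b' e' f h => by
      calc _ = c * (Real.exp a * (Real.exp b * Real.exp e)) := by ring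
        _ = c * (Real.exp f * (Real.exp a' * (Real.exp b' * Real.exp e'))) := by
          simp only [← Real.exp_add, h]
        _ = _ := by ring
  refine this _ _ _ _ _ _ _ ?_
  rw [hlam]
  field_simp
  ring

section Normalized

variable {hΓ : Γ.PosDef} {hc : 0 < c} {hr : 0 < r}

lemma gaussForm_gaussL1_of_normalized
    (h1 : gaussForm hΓ hc hr (gaussL1 hΓ 0) (gaussL1 hΓ 0) = 1) (t w : Space p) (a b : ℝ) :
    gaussForm hΓ hc hr (gaussL1 hΓ (t + a • w)) (gaussL1 hΓ (t + b • w))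
      = Real.exp (-(1 / (2 * (r + 2))) * mahalSq Γ w * (a - b) ^ 2) := by
  rw [gaussForm_gaussL1, h1, mul_one, add_sub_add_left_eq_sub, ← sub_smul, mahalSq_smul]
  congr 1
  ring

lemma hasDerivAt_exp_neg_mul_sq (m x : ℝ) :
    HasDerivAt (fun x : ℝ => Real.exp (-m * x ^ 2)) (-(2 * m * x) * Real.exp (-m * x ^ 2)) x := by
  refine (((hasDerivAt_pow 2 x).const_mul (-m)).exp).congr_deriv ?_
  push_cast
  ring

/-- Along a line the kernel product is $e^{-m(a-b)^2}$. Differentiating in $a$ at $0$ gives this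
formula; differentiating the result in $b$ at $0$ gives `gaussForm_gaussL1Deriv_self`. -/
lemma gaussForm_gaussL1Deriv_gaussL1
    (h1 : gaussForm hΓ hc hr (gaussL1 hΓ 0) (gaussL1 hΓ 0) = 1) (t w : Space p) (b : ℝ) :
    gaussForm hΓ hc hr (gaussL1Deriv hΓ t w) (gaussL1 hΓ (t + b • w))
      = b * (1 / (r + 2) * mahalSq Γ w) *
        Real.exp (-(1 / (2 * (r + 2)) * mahalSq Γ w) * b ^ 2) := by
  have h2 := ((gaussForm hΓ hc hr).flip (gaussL1 hΓ (t + b • w))).hasFDerivAt.comp_hasDerivAt 0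
    (hasDerivAt_gaussL1 hΓ t w 0)
  rw [zero_smul, add_zero] at h2
  refine h2.unique ?_
  simp only [Function.comp_def, ContinuousLinearMap.flip_apply,
    gaussForm_gaussL1_of_normalized h1]
  have h3 := (hasDerivAt_exp_neg_mul_sq (1 / (2 * (r + 2)) * mahalSq Γ w) (0 - b)).comp 0
    ((hasDerivAt_id (0 : ℝ)).sub_const b)
  simp only [Function.comp_def, id, ← neg_mul] at h3 ⊢
  refine h3.congr_deriv ?_
  rw [zero_sub, neg_sq]
  field_simp

lemma gaussForm_gaussL1Deriv_gaussL1_self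
    (h1 : gaussForm hΓ hc hr (gaussL1 hΓ 0) (gaussL1 hΓ 0) = 1) (t w : Space p) :
    gaussForm hΓ hc hr (gaussL1Deriv hΓ t w) (gaussL1 hΓ t) = 0 := by
  simpa using gaussForm_gaussL1Deriv_gaussL1 h1 t w 0

lemma gaussForm_gaussL1Deriv_self
    (h1 : gaussForm hΓ hc hr (gaussL1 hΓ 0) (gaussL1 hΓ 0) = 1) (t w : Space p) :
    gaussForm hΓ hc hr (gaussL1Deriv hΓ t w) (gaussL1Deriv hΓ t w)
      = 1 / (r + 2) * mahalSq Γ w := by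
  have h2 := (gaussForm hΓ hc hr (gaussL1Deriv hΓ t w)).hasFDerivAt.comp_hasDerivAt 0
    (hasDerivAt_gaussL1 hΓ t w 0)
  rw [zero_smul, add_zero] at h2
  refine h2.unique ?_
  simp only [Function.comp_def, gaussForm_gaussL1Deriv_gaussL1 h1]
  refine (((hasDerivAt_id (0 : ℝ)).mul_const (1 / (r + 2) * mahalSq Γ w)).mul
    (hasDerivAt_exp_neg_mul_sq (1 / (2 * (r + 2)) * mahalSq Γ w) 0)).congr_deriv ?_
  simp

/-- The cross term vanishes because $\mu_t$ has constant kernel norm and is thus orthogonal to its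
derivative. -/
lemma gaussForm_add_self
    (h1 : gaussForm hΓ hc hr (gaussL1 hΓ 0) (gaussL1 hΓ 0) = 1) (t w : Space p) (v a : ℝ) :
    gaussForm hΓ hc hr (v • gaussL1 hΓ t + a • gaussL1Deriv hΓ t w)
        (v • gaussL1 hΓ t + a • gaussL1Deriv hΓ t w)
      = v ^ 2 + a ^ 2 * (1 / (r + 2) * mahalSq Γ w) := by
  have h2 : gaussForm hΓ hc hr (gaussL1 hΓ t) (gaussL1 hΓ t) = 1 := by
    simpa [mahalSq, h1] using gaussForm_gaussL1 hΓ hc hr t t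
  simp only [_root_.map_add, _root_.map_smul, _root_.add_apply, _root_.smul_apply,
    smul_eq_mul, gaussForm_comm hΓ hc hr (gaussL1 hΓ t) (gaussL1Deriv hΓ t w), h2,
    gaussForm_gaussL1Deriv_gaussL1_self h1, gaussForm_gaussL1Deriv_self h1]
  ring

lemma kernelNormSq_dGaussian
    (h1 : gaussForm hΓ hc hr (gaussL1 hΓ 0) (gaussL1 hΓ 0) = 1) (t w : Space p) :
    kernelNormSq (gaussianKernel Γ c r) (dGaussian Γ w t) = 1 / (r + 2) * mahalSq Γ w := by
  rw [← density_gaussL1Deriv hΓ, kernelNormSq_eq_gaussForm hΓ hc hr,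
    gaussForm_gaussL1Deriv_self h1]

lemma dConst_mul_sq_le
    (h1 : gaussForm hΓ hc hr (gaussL1 hΓ 0) (gaussL1 hΓ 0) = 1) (w : Space p) :
    dConst Γ (gaussianKernel Γ c r) * ‖w‖ ^ 2 ≤ 1 / (r + 2) * mahalSq Γ w := by
  rcases eq_or_ne w 0 with rfl | hw
  · simp [mahalSq]
  have hw' : 0 < ‖w‖ := norm_pos_iff.2 hw
  have h2 : dConst Γ (gaussianKernel Γ c r) ≤
      kernelNormSq (gaussianKernel Γ c r) (dGaussian Γ (‖w‖⁻¹ • w) 0) := by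
    refine csInf_le ⟨0, ?_⟩ ⟨_, ?_, rfl⟩
    · rintro _ ⟨u, -, rfl⟩
      simp only [kernelNormSq_dGaussian h1]
      exact mul_nonneg (by positivity) (mahalSq_nonneg hΓ u)
    · simp [norm_smul, hw'.ne']
  rw [kernelNormSq_dGaussian h1, mahalSq_smul, mul_left_comm] at h2
  calc _ ≤ ‖w‖⁻¹ ^ 2 * (1 / (r + 2) * mahalSq Γ w) * ‖w‖ ^ 2 := by gcongr
    _ = _ := by field_simp

/-- The assumption $p\ge1$ enters through nonemptiness of the unit sphere: the infimum over an empty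
set would be $0$. -/
lemma dConst_pos
    (h1 : gaussForm hΓ hc hr (gaussL1 hΓ 0) (gaussL1 hΓ 0) = 1) :
    0 < dConst Γ (gaussianKernel Γ c r) := by
  obtain ⟨δ, hδ, hlow⟩ := exists_pos_mul_sq_le_mahalSq hΓ
  refine lt_of_lt_of_le (b := 1 / (r + 2) * δ) (by positivity) (le_csInf ?_ ?_)
  · exact (NormedSpace.sphere_nonempty.2 zero_le_one).image _
  · rintro _ ⟨u, hu, rfl⟩
    simp only [kernelNormSq_dGaussian h1]
    have := hlow u
    rw [mem_sphere_zero_iff_norm.1 hu, one_pow, mul_one] at this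
    gcongr

/-- Apply the bound on the first derivative with the direction $w=\Gamma^{-1}x$ depending on the
point. The inner product becomes $\|w\|^2$, and one factor $\|w\|$ cancels. -/
lemma integrable_norm_precMul_mul (hΓ : Γ.PosDef) :
    Integrable fun x => ‖precMul Γ x‖ * gaussianDensity Γ 0 x := by
  obtain ⟨N, hN, h⟩ := exists_majorant hΓ
  have hcont : Continuous fun x => ‖precMul Γ x‖ * gaussianDensity Γ 0 x :=
    continuous_precMul.norm.mul (continuous_gaussianDensity 0)
  refine hN.mono' hcont.aestronglyMeasurable (Eventually.of_forall fun x => ?_)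
  have hg : 0 ≤ gaussianDensity Γ 0 x := (Real.exp_pos _).le
  have h2 := h (precMul Γ x) 0 0 x (by simp)
  rw [Real.norm_of_nonneg (by positivity)]
  rcases (norm_nonneg (precMul Γ x)).eq_or_lt with h0 | h0
  · rw [← h0, zero_mul]
    simpa using (abs_nonneg _).trans h2.1
  · have h3 := h2.2.1
    rw [gaussianDeriv₁, add_zero, sub_zero, real_inner_self_eq_norm_sq, pow_two, mul_assoc,
      abs_of_nonneg (by positivity)] at h3
    exact le_of_mul_le_mul_left h3 h0

/-- Cauchy–Schwarz at each pair of points; nonnegativity of the kernel preserves the inequality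
under the integral. -/
lemma gaussForm_gaussL1Deriv_self_le_DConst (w : Space p) :
    gaussForm hΓ hc hr (gaussL1Deriv hΓ 0 w) (gaussL1Deriv hΓ 0 w)
      ≤ ‖w‖ ^ 2 * DConst Γ (gaussianKernel Γ c r) := by
  have hI := integrable_kernel_mul (K := gaussianKernel Γ c r) measurable_gaussianKernel
    (abs_gaussianKernel_le hΓ hc hr) (integrable_norm_precMul_mul hΓ)
    (integrable_norm_precMul_mul hΓ)
  have hD : DConst Γ (gaussianKernel Γ c r) = ∫ z : Space p × Space p,
      gaussianKernel Γ c r z.1 z.2 * ((‖precMul Γ z.1‖ * gaussianDensity Γ 0 z.1) *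
        (‖precMul Γ z.2‖ * gaussianDensity Γ 0 z.2)) ∂(volume.prod volume) := by
    rw [integral_prod _ hI, DConst]
    congr 1 with x
    congr 1 with y
    rw [gaussianKernel, gaussianKernel, ← mahalSq_neg, neg_sub]
    ring
  rw [hD, gaussForm, gaussL1Deriv_apply, kernelForm_toL1, ← integral_const_mul]
  refine integral_mono (integrable_kernel_mul measurable_gaussianKernel
    (abs_gaussianKernel_le hΓ hc hr) (integrable_gaussianDeriv₁ hΓ w 0)
    (integrable_gaussianDeriv₁ hΓ w 0)) (hI.const_mul _) fun z => ?_
  have h : ∀ x, |gaussianDeriv₁ Γ w 0 x| ≤ ‖w‖ * (‖precMul Γ x‖ * gaussianDensity Γ 0 x) :=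
    fun x => by
      have hg : 0 ≤ gaussianDensity Γ 0 x := (Real.exp_pos _).le
      rw [gaussianDeriv₁, sub_zero, abs_mul, abs_of_nonneg hg, ← mul_assoc]
      exact mul_le_mul_of_nonneg_right (abs_real_inner_le_norm _ _) hg
  have h2 : gaussianDeriv₁ Γ w 0 z.1 * gaussianDeriv₁ Γ w 0 z.2
      ≤ (‖w‖ * (‖precMul Γ z.1‖ * gaussianDensity Γ 0 z.1)) *
        (‖w‖ * (‖precMul Γ z.2‖ * gaussianDensity Γ 0 z.2)) := by
    refine (le_abs_self _).trans ?_
    rw [abs_mul]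
    exact mul_le_mul (h _) (h _) (abs_nonneg _) ((abs_nonneg _).trans (h _))
  refine (mul_le_mul_of_nonneg_left h2 (gaussianKernel_nonneg hc _ _)).trans_eq ?_
  ring

lemma mahalSq_le_DConst
    (h1 : gaussForm hΓ hc hr (gaussL1 hΓ 0) (gaussL1 hΓ 0) = 1) (w : Space p) :
    1 / (r + 2) * mahalSq Γ w ≤ ‖w‖ ^ 2 * DConst Γ (gaussianKernel Γ c r) := by
  rw [← gaussForm_gaussL1Deriv_self h1 0 w]
  exact gaussForm_gaussL1Deriv_self_le_DConst w

lemma DConst_pos (h1 : gaussForm hΓ hc hr (gaussL1 hΓ 0) (gaussL1 hΓ 0) = 1) :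
    0 < DConst Γ (gaussianKernel Γ c r) := by
  obtain ⟨u, hu⟩ := NormedSpace.sphere_nonempty (E := Space p) (x := 0).2 zero_le_one
  have h2 := (dConst_mul_sq_le h1 u).trans (mahalSq_le_DConst h1 u)
  rw [mem_sphere_zero_iff_norm.1 hu, one_pow, mul_one, one_mul] at h2
  exact (dConst_pos h1).trans_le h2

end Normalized

end Kernel

lemma hasDerivAt_line {E : Type*} [NormedAddCommGroup E] [NormedSpace ℝ E] (θ e : E) (s : ℝ) :
    HasDerivAt (fun s : ℝ => θ + s • e) e s := by
  simpa using ((hasDerivAt_id s).smul_const e).const_add θ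

/-! ### Gradient descent -/

/-- Gradient descent converges from a ball around `θs` on which the gradient is strongly monotone
and Lipschitz at `θs`. -/
lemma isBasin_of_inner_gradient_ge {k p : ℕ} {g : Param k p → ℝ} {θs : Param k p} {β κ L : ℝ}
    (hβ : 0 < β) (hκ : 0 < κ) (hcont : ContinuousAt g θs)
    (hmono : ∀ θ, ‖θ - θs‖ < β → κ * ‖θ - θs‖ ^ 2 ≤ inner ℝ (gradient g θ) (θ - θs))
    (hlip : ∀ θ, ‖θ - θs‖ < β → ‖gradient g θ‖ ≤ L * ‖θ - θs‖) :
    IsBasin g θs {θ | ‖θ - θs‖ < β} := by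
  refine ⟨by simpa using hβ, ?_⟩
  set M := max L κ with hM
  have hM0 : 0 < M := hκ.trans_le (le_max_right _ _)
  -- This step minimizes the contraction factor $1-2\tau\kappa+\tau^2M^2$, with minimum
  -- $1-\kappa^2/M^2$. Taking $M\ge\kappa$ keeps that factor nonnegative.
  set τ := κ / M ^ 2 with hτ
  have hτ0 : 0 < τ := by positivity
  refine ⟨τ, hτ0, fun θ₀ hθ₀ => ?_⟩
  set q := 1 - κ ^ 2 / M ^ 2 with hq
  have hq0 : 0 ≤ q := by
    rw [hq, sub_nonneg, div_le_one (by positivity)]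
    exact pow_le_pow_left₀ hκ.le (le_max_right _ _) 2
  have hq1 : q < 1 := by
    have : 0 < κ ^ 2 / M ^ 2 := by positivity
    linarith
  have step : ∀ θ, ‖θ - θs‖ < β → ‖θ - τ • gradient g θ - θs‖ ^ 2 ≤ q * ‖θ - θs‖ ^ 2 :=
    fun θ hθ => by
      have e : θ - τ • gradient g θ - θs = (θ - θs) - τ • gradient g θ := by abel
      rw [e, norm_sub_sq_real, inner_smul_right, real_inner_comm, norm_smul,
        Real.norm_of_nonneg hτ0.le]
      have h1 := hmono θ hθ
      have h2 : ‖gradient g θ‖ ^ 2 ≤ M ^ 2 * ‖θ - θs‖ ^ 2 := by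
        rw [← mul_pow]
        refine pow_le_pow_left₀ (norm_nonneg _) ((hlip θ hθ).trans ?_) 2
        gcongr
        exact le_max_left _ _
      have h3 : τ ^ 2 * M ^ 2 = τ * κ := by rw [hτ]; field_simp
      have h4 : q = 1 - τ * κ := by rw [hq, hτ]; field_simp
      have h5 : (τ * ‖gradient g θ‖) ^ 2 ≤ τ * κ * ‖θ - θs‖ ^ 2 := by
        rw [mul_pow, ← h3, mul_assoc]
        gcongr
      have h6 := mul_le_mul_of_nonneg_left h1 hτ0.le
      rw [h4]
      nlinarith
  have hn : ∀ n : ℕ, ‖(fun θ => θ - τ • gradient g θ)^[n] θ₀ - θs‖ < β ∧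
      ‖(fun θ => θ - τ • gradient g θ)^[n] θ₀ - θs‖ ^ 2 ≤ q ^ n * ‖θ₀ - θs‖ ^ 2 := fun n => by
    induction n with
    | zero => exact ⟨hθ₀, by simp⟩
    | succ n ih =>
      rw [Function.iterate_succ_apply']
      have h1 := step _ ih.1
      constructor
      · refine lt_of_le_of_lt (abs_le_of_sq_le_sq' (h1.trans ?_) (norm_nonneg _)).2 ih.1
        exact mul_le_of_le_one_left (sq_nonneg _) hq1.le
      · refine h1.trans ?_
        rw [pow_succ' q, mul_assoc]
        exact mul_le_mul_of_nonneg_left ih.2 hq0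
  have hlim : Tendsto (fun n : ℕ => (fun θ => θ - τ • gradient g θ)^[n] θ₀) atTop (𝓝 θs) := by
    rw [tendsto_iff_norm_sub_tendsto_zero]
    have h1 : Tendsto (fun n : ℕ => q ^ n * ‖θ₀ - θs‖ ^ 2) atTop (𝓝 0) := by
      simpa using (tendsto_pow_atTop_nhds_zero_of_lt_one hq0 hq1).mul_const (‖θ₀ - θs‖ ^ 2)
    have h2 := squeeze_zero (fun n => sq_nonneg _) (fun n => (hn n).2) h1
    simpa using h2.sqrt
  exact hcont.tendsto.comp hlim

/-- A curve whose second derivative is small compared with its initial velocity `h' 0` satisfies a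
strong monotonicity inequality between its endpoints. -/
lemma inner_sub_deriv_ge {W : Type*} [NormedAddCommGroup W] [InnerProductSpace ℝ W]
    {h h' h'' : ℝ → W} (h1 : ∀ s, HasDerivAt h (h' s) s) (h2 : ∀ s, HasDerivAt h' (h'' s) s)
    (hb : ∀ s ∈ Set.Icc (0 : ℝ) 1, ‖h'' s‖ ≤ 1 / 5 * ‖h' 0‖) :
    1 / 2 * ‖h' 0‖ ^ 2 ≤ inner ℝ (h 1 - h 0) (h' 1) := by
  have e1 := norm_taylor_le h1 h2 hb
  have e2 := norm_sub_le_of_norm_deriv_le h2 hb (s := 1) (by simp)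
  set E₁ := h 1 - h 0 - h' 0
  set E₂ := h' 1 - h' 0
  have a1 : h 1 - h 0 = h' 0 + E₁ := by simp [E₁]
  have a2 : h' 1 = h' 0 + E₂ := by simp [E₂]
  rw [a1, a2, inner_add_left, inner_add_right, inner_add_right, real_inner_self_eq_norm_sq]
  have b1 := (abs_le.1 (abs_real_inner_le_norm (h' 0) E₂)).1
  have b2 := (abs_le.1 (abs_real_inner_le_norm E₁ (h' 0))).1
  have b3 := (abs_le.1 (abs_real_inner_le_norm E₁ E₂)).1
  have n0 := norm_nonneg (h' 0)
  have c1 : ‖h' 0‖ * ‖E₂‖ ≤ ‖h' 0‖ * (1 / 5 * ‖h' 0‖) := by gcongr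
  have c2 : ‖E₁‖ * ‖h' 0‖ ≤ 1 / 5 * ‖h' 0‖ * ‖h' 0‖ := by gcongr
  have c3 : ‖E₁‖ * ‖E₂‖ ≤ (1 / 5 * ‖h' 0‖) * (1 / 5 * ‖h' 0‖) := by gcongr
  -- The three error terms leave $1-\frac15-\frac15-\frac1{25}=\frac{14}{25}\ge\frac12$ of
  -- $\|h'(0)\|^2$.
  nlinarith

/-! ### The parameter space -/

section Mixture

variable {k p : ℕ} {Γ : Matrix (Fin p) (Fin p) ℝ}

/-- The amplitude of the `i`-th component, as a linear form. -/
def ampCLM (i : Fin k) : Param k p →L[ℝ] ℝ :=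
  (EuclideanSpace.proj i).comp (WithLp.fstL 2 ℝ _ _)

/-- The mean of the `i`-th component, as a linear map. -/
def meanCLM (i : Fin k) : Param k p →L[ℝ] Space p :=
  (PiLp.proj 2 (fun _ : Fin k => Space p) i).comp (WithLp.sndL 2 ℝ _ _)

lemma param_norm_sq (e : Param k p) : ‖e‖ ^ 2 = ∑ i, (e.fst i ^ 2 + ‖e.snd i‖ ^ 2) := by
  rw [WithLp.prod_norm_sq_eq_of_L2, EuclideanSpace.norm_sq_eq, PiLp.norm_sq_eq_of_L2,
    Finset.sum_add_distrib]
  simp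

lemma sq_fst_add_sq_snd_le (e : Param k p) (i : Fin k) :
    e.fst i ^ 2 + ‖e.snd i‖ ^ 2 ≤ ‖e‖ ^ 2 := by
  rw [param_norm_sq]
  exact Finset.single_le_sum (f := fun i => e.fst i ^ 2 + ‖e.snd i‖ ^ 2)
    (fun i _ => by positivity) (Finset.mem_univ i)

lemma abs_fst_le (e : Param k p) (i : Fin k) : |e.fst i| ≤ ‖e‖ := by
  refine abs_le_of_sq_le_sq ?_ (norm_nonneg _)
  nlinarith [sq_fst_add_sq_snd_le e i, sq_nonneg ‖e.snd i‖]

lemma norm_snd_le (e : Param k p) (i : Fin k) : ‖e.snd i‖ ≤ ‖e‖ := by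
  refine (abs_le_of_sq_le_sq' ?_ (norm_nonneg _)).2
  nlinarith [sq_fst_add_sq_snd_le e i, sq_nonneg (e.fst i)]

/-! ### Mixtures in `L¹` -/

variable [NeZero p]

/-- The density of the mixture `φ(θ)` in `L¹`. -/
def mixL1 (hΓ : Γ.PosDef) (θ : Param k p) : Space p →₁[volume] ℝ :=
  ∑ i, θ.fst i • gaussL1 hΓ (θ.snd i)

/-- The derivative of the density of `φ(θ)` in `L¹`. -/
def mixL1Deriv (hΓ : Γ.PosDef) (θ : Param k p) : Param k p →L[ℝ] (Space p →₁[volume] ℝ) :=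
  ∑ i, (θ.fst i • (gaussL1Deriv hΓ (θ.snd i)).comp (meanCLM i) +
    (ampCLM i).smulRight (gaussL1 hΓ (θ.snd i)))

/-- The second derivative of the density of `φ(θ)` in the direction `e`, in `L¹`. -/
def mixL1Deriv₂ (hΓ : Γ.PosDef) (e θ : Param k p) : Space p →₁[volume] ℝ :=
  ∑ i, ((2 * e.fst i) • gaussL1Deriv hΓ (θ.snd i) (e.snd i) +
    θ.fst i • gaussL1Deriv₂ hΓ (e.snd i) (θ.snd i))

lemma density_mixL1 (hΓ : Γ.PosDef) (θ : Param k p) :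
    density volume (mixL1 hΓ θ) = phi Γ θ := by
  simp only [mixL1, density_sum, density_smul, density_gaussL1, phi]

lemma mixL1Deriv_apply (hΓ : Γ.PosDef) (θ e : Param k p) :
    mixL1Deriv hΓ θ e = ∑ i, (e.fst i • gaussL1 hΓ (θ.snd i) +
      θ.fst i • gaussL1Deriv hΓ (θ.snd i) (e.snd i)) := by
  simp only [mixL1Deriv, _root_.sum_apply]
  refine Finset.sum_congr rfl fun i _ => ?_
  rw [add_comm]
  rfl

lemma hasFDerivAt_mixL1 (hΓ : Γ.PosDef) (θ : Param k p) :
    HasFDerivAt (mixL1 hΓ) (mixL1Deriv hΓ θ) θ := by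
  refine HasFDerivAt.fun_sum fun i _ => ?_
  have h : HasFDerivAt (fun θ : Param k p => gaussL1 hΓ (meanCLM i θ))
      ((gaussL1Deriv hΓ (θ.snd i)).comp (meanCLM i)) θ :=
    HasFDerivAt.comp (g := gaussL1 hΓ) θ (hasFDerivAt_gaussL1 hΓ (θ.snd i))
      (meanCLM i).hasFDerivAt
  exact (ampCLM i).hasFDerivAt.fun_smul h

lemma hasDerivAt_mixL1 (hΓ : Γ.PosDef) (θ e : Param k p) (s : ℝ) :
    HasDerivAt (fun s : ℝ => mixL1 hΓ (θ + s • e)) (mixL1Deriv hΓ (θ + s • e) e) s :=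
  HasFDerivAt.comp_hasDerivAt (l := mixL1 hΓ) s (hasFDerivAt_mixL1 hΓ (θ + s • e))
    (hasDerivAt_line θ e s)

lemma hasDerivAt_mixL1Deriv (hΓ : Γ.PosDef) (θ e : Param k p) (s : ℝ) :
    HasDerivAt (fun s : ℝ => mixL1Deriv hΓ (θ + s • e) e) (mixL1Deriv₂ hΓ e (θ + s • e)) s := by
  simp only [mixL1Deriv_apply]
  refine HasDerivAt.fun_sum fun i _ => ?_
  have ha : HasDerivAt (fun s : ℝ => (θ + s • e).fst i) (e.fst i) s :=
    (ampCLM i).hasFDerivAt.comp_hasDerivAt s (hasDerivAt_line θ e s)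
  have h1 := (hasDerivAt_gaussL1 hΓ (θ.snd i) (e.snd i) s).const_smul (e.fst i)
  have h2 := ha.fun_smul (hasDerivAt_gaussL1Deriv hΓ (θ.snd i) (e.snd i) s)
  refine (h1.fun_add h2).congr_deriv ?_
  rw [two_mul, add_smul]
  change _ = (e.fst i • gaussL1Deriv hΓ (θ.snd i + s • e.snd i) (e.snd i) +
    e.fst i • gaussL1Deriv hΓ (θ.snd i + s • e.snd i) (e.snd i)) +
    (θ + s • e).fst i • gaussL1Deriv₂ hΓ (e.snd i) (θ.snd i + s • e.snd i)
  abel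

/-- Component bounds are uniform in the means, so only the amplitudes need the ball. The resulting
$L$ serves qualitatively: it makes `lipConst` a finite supremum and the gradient at most linear in
the distance to `θs`. -/
lemma exists_norm_mixL1Deriv_le (hΓ : Γ.PosDef) (θs : Param k p) (ρ : ℝ) :
    ∃ L, 0 ≤ L ∧ ∀ θ, ‖θ - θs‖ < ρ → ‖mixL1Deriv hΓ θ‖ ≤ L := by
  obtain ⟨C, hC, h⟩ := exists_norm_gaussL1_le hΓ
  refine ⟨∑ _ : Fin k, (C + (‖θs‖ + |ρ|) * C), by positivity, fun θ hθ => ?_⟩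
  refine ContinuousLinearMap.opNorm_le_bound _ (by positivity) fun e => ?_
  rw [mixL1Deriv_apply, Finset.sum_mul]
  refine (norm_sum_le _ _).trans (Finset.sum_le_sum fun i _ => (norm_add_le _ _).trans ?_)
  have h1 := h (θ.snd i) (e.snd i)
  have h2 : ‖θ‖ ≤ ‖θs‖ + |ρ| := by
    have := norm_add_le θs (θ - θs)
    rw [add_sub_cancel] at this
    linarith [le_abs_self ρ]
  rw [norm_smul, norm_smul, Real.norm_eq_abs, Real.norm_eq_abs, add_mul, mul_assoc, mul_comm C ‖e‖]
  refine add_le_add ?_ ?_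
  · exact mul_le_mul (abs_fst_le e i) h1.1 (norm_nonneg _) (norm_nonneg _)
  · exact mul_le_mul ((abs_fst_le θ i).trans h2)
      (h1.2.trans ((mul_comm _ _).trans_le (mul_le_mul_of_nonneg_right (norm_snd_le e i) hC)))
      (norm_nonneg _) (by positivity)

lemma norm_mixL1_sub_le (hΓ : Γ.PosDef) {θs : Param k p} {ρ L : ℝ}
    (hL : ∀ θ, ‖θ - θs‖ < ρ → ‖mixL1Deriv hΓ θ‖ ≤ L) {θ : Param k p} (hθ : ‖θ - θs‖ < ρ) :
    ‖mixL1 hΓ θ - mixL1 hΓ θs‖ ≤ L * ‖θ - θs‖ := by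
  refine (convex_ball θs ρ).norm_image_sub_le_of_norm_hasFDerivWithin_le (𝕜 := ℝ)
    (f' := mixL1Deriv hΓ)
    (fun x _ => (hasFDerivAt_mixL1 hΓ x).hasFDerivWithinAt)
    (fun x hx => hL x (mem_ball_iff_norm.1 hx)) ?_ (mem_ball_iff_norm.2 hθ)
  exact Metric.mem_ball_self ((norm_nonneg _).trans_lt hθ)

end Mixture

/-! ### Tangent vectors of the model: separation, isometry, coherence and second-derivative bounds.
-/

section Basin

variable {k p m : ℕ} {Γ : Matrix (Fin p) (Fin p) ℝ} {c r ε γ R cK : ℝ}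

/-- Openness keeps $\theta+se$ feasible for small $s$, so tangent vectors are limits of rescaled
secants of the model. -/
lemma isOpen_Theta : IsOpen (Theta k Γ ε R) := by
  have h1 : ∀ i j : Fin k, Continuous fun θ : Param k p => mahal Γ (θ.snd i - θ.snd j) :=
    fun i j => (continuous_mahalSq.comp ((meanCLM i).continuous.sub (meanCLM j).continuous)).sqrt
  have h2 : ∀ i : Fin k, Continuous fun θ : Param k p => ‖θ.snd i‖ :=
    fun i => (meanCLM i).continuous.norm
  simp only [Theta, Set.ofPred_and, Set.ofPred_forall]
  refine IsOpen.inter (isOpen_iInter_of_finite fun i => isOpen_iInter_of_finite fun j =>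
    isOpen_iInter_of_finite fun _ => ?_) (isOpen_iInter_of_finite fun i => ?_)
  · exact isOpen_lt continuous_const (h1 i j)
  · exact isOpen_lt (h2 i) continuous_const

lemma inner_gradient_norm_sq {H W : Type*} [NormedAddCommGroup H] [InnerProductSpace ℝ H]
    [CompleteSpace H] [NormedAddCommGroup W] [InnerProductSpace ℝ W] {F : H → W} {F' : H →L[ℝ] W}
    {θ : H} (hF : HasFDerivAt F F' θ) (y : W) (v : H) :
    inner ℝ (gradient (fun θ => ‖F θ - y‖ ^ 2) θ) v = 2 * inner ℝ (F θ - y) (F' v) := by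
  have h := (hF.sub_const y).norm_sq
  have h2 := h.differentiableAt.hasGradientAt.hasFDerivAt.unique h
  have h3 := congrArg (fun T => T v) h2
  simpa [inner_sub_left] using h3

lemma continuousAt_norm_sub_sq {H W : Type*} [NormedAddCommGroup H] [NormedSpace ℝ H]
    [NormedAddCommGroup W] [NormedSpace ℝ W] {F : H → W} {F' : H →L[ℝ] W} {θ : H}
    (hF : HasFDerivAt F F' θ) (y : W) : ContinuousAt (fun θ => ‖F θ - y‖ ^ 2) θ :=
  ((hF.continuousAt.sub continuousAt_const).norm).pow 2

variable [NeZero p]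

/-- Differences of means move by at most $2\beta\le\varepsilon\sqrt{\lambda_{\min}}/4$, that is, by
at most $\varepsilon/4$ in Mahalanobis norm. The parallelogram bound then leaves a squared
separation above $\frac7{16}\varepsilon^2\ge(\varepsilon/2)^2$. -/
lemma mem_Theta_half_of_norm_sub_lt (hΓ : Γ.PosDef) (hε : 0 < ε) {θs θ : Param k p} {β : ℝ}
    (hθs : θs ∈ Theta k Γ ε R) (hβ : β ≤ ε * √(lambdaMin hΓ.isHermitian) / 8)
    (hR : ∀ i, ‖θs.snd i‖ ≤ R - 2 * β) (hθ : ‖θ - θs‖ < β) : θ ∈ Theta k Γ (ε / 2) R := by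
  have hlam := lambdaMin_pos hΓ
  have hd : ∀ i, ‖θ.snd i - θs.snd i‖ < β := fun i => (norm_snd_le (θ - θs) i).trans_lt hθ
  refine ⟨fun i j hij => ?_, fun i => ?_⟩
  · set u := θs.snd i - θs.snd j with hu
    set v := θ.snd i - θ.snd j with hv
    have h1 : ‖v - u‖ ≤ 2 * β := by
      have e : v - u = (θ.snd i - θs.snd i) - (θ.snd j - θs.snd j) := by rw [hu, hv]; abel
      rw [e]
      linarith [norm_sub_le (θ.snd i - θs.snd i) (θ.snd j - θs.snd j), hd i, hd j]
    have h2 : mahalSq Γ (v - u) ≤ ε ^ 2 / 16 := by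
      refine (mahalSq_le hΓ _).trans ?_
      have h3 : ‖v - u‖ ^ 2 ≤ (ε * √(lambdaMin hΓ.isHermitian) / 4) ^ 2 :=
        pow_le_pow_left₀ (norm_nonneg _) (by linarith) 2
      rw [div_pow, mul_pow, Real.sq_sqrt hlam.le] at h3
      calc _ ≤ 1 / lambdaMin hΓ.isHermitian * (ε ^ 2 * lambdaMin hΓ.isHermitian / 4 ^ 2) := by
            gcongr
        _ = _ := by field_simp; norm_num
    have h3 : ε ^ 2 < mahalSq Γ u := by
      have := hθs.1 i j hij
      rwa [mahal, Real.lt_sqrt hε.le] at this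
    have h4 := mahalSq_sub_le hΓ v (v - u)
    rw [sub_sub_cancel] at h4
    rw [mahal, Real.lt_sqrt (by positivity)]
    nlinarith
  · have h1 := norm_add_le (θs.snd i) (θ.snd i - θs.snd i)
    rw [add_sub_cancel] at h1
    linarith [hR i, hd i, norm_nonneg (θ.snd i - θs.snd i)]

variable {hΓ : Γ.PosDef} {hc : 0 < c} {hr : 0 < r} {α : Fin m → (Space p →ᵇ ℂ)}

lemma measure_phi (hΓ : Γ.PosDef) (α : Fin m → (Space p →ᵇ ℂ)) (θ : Param k p) :
    measure α (phi Γ θ) = measureCLM α (mixL1 hΓ θ) := by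
  rw [← density_mixL1 hΓ, measure_density]

lemma tendsto_slope_mixL1 (hΓ : Γ.PosDef) (θ e : Param k p) :
    Tendsto (fun s : ℝ => s⁻¹ • (mixL1 hΓ (θ + s • e) - mixL1 hΓ θ)) (𝓝[≠] 0)
      (𝓝 (mixL1Deriv hΓ θ e)) := by
  simpa using hasDerivAt_iff_tendsto_slope_zero.1 (hasDerivAt_mixL1 hΓ θ e 0)

omit [NeZero p] in
lemma tendsto_line (θ e : Param k p) :
    Tendsto (fun s : ℝ => θ + s • e) (𝓝[≠] 0) (𝓝 θ) := by
  have := (hasDerivAt_line θ e 0).continuousAt.tendsto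
  rw [zero_smul, add_zero] at this
  exact this.mono_left nhdsWithin_le_nhds

omit [NeZero p] in
lemma continuous_gaussForm_self :
    Continuous fun f : Space p →₁[volume] ℝ => gaussForm hΓ hc hr f f :=
  (gaussForm hΓ hc hr).continuous.clm_apply continuous_id

omit [NeZero p] in
lemma gaussForm_smul_self (a : ℝ) (f : Space p →₁[volume] ℝ) :
    gaussForm hΓ hc hr (a • f) (a • f) = a ^ 2 * gaussForm hΓ hc hr f f := by
  simp only [_root_.map_smul, _root_.smul_apply, smul_eq_mul]
  ring

/-- The restricted isometry property passes to tangent vectors of the model. -/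
lemma HasRIP.mixL1Deriv (hRIP : HasRIP α (gaussianKernel Γ c r) (secants (Model k Γ ε R)) γ)
    {θ : Param k p} (hθ : θ ∈ Theta k Γ ε R) (e : Param k p) :
    (1 - γ) * gaussForm hΓ hc hr (mixL1Deriv hΓ θ e) (mixL1Deriv hΓ θ e)
        ≤ ‖measureCLM α (mixL1Deriv hΓ θ e)‖ ^ 2 ∧
      ‖measureCLM α (mixL1Deriv hΓ θ e)‖ ^ 2
        ≤ (1 + γ) * gaussForm hΓ hc hr (mixL1Deriv hΓ θ e) (mixL1Deriv hΓ θ e) := by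
  have hA : Continuous fun f => ‖measureCLM α f‖ ^ 2 := (measureCLM α).continuous.norm.pow 2
  have hB := continuous_gaussForm_self (hΓ := hΓ) (hc := hc) (hr := hr)
  -- Both inequalities are quadratic in $f$, hence stable under scaling, and continuous in $L^1$,
  -- hence stable under limits.
  have hclosed : IsClosed {f : Space p →₁[volume] ℝ |
      (1 - γ) * gaussForm hΓ hc hr f f ≤ ‖measureCLM α f‖ ^ 2 ∧
      ‖measureCLM α f‖ ^ 2 ≤ (1 + γ) * gaussForm hΓ hc hr f f} :=
    (isClosed_le (continuous_const.mul hB) hA).inter (isClosed_le hA (continuous_const.mul hB))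
  refine hclosed.mem_of_tendsto (tendsto_slope_mixL1 hΓ θ e) ?_
  filter_upwards [(tendsto_line θ e).eventually (isOpen_Theta.mem_nhds hθ)] with s hs
  have h := hRIP (density volume (mixL1 hΓ (θ + s • e) - mixL1 hΓ θ)) ⟨_, ⟨_, hs, rfl⟩, _,
    ⟨_, hθ, rfl⟩, by rw [density_sub, density_mixL1, density_mixL1]⟩
  rw [kernelNormSq_eq_gaussForm hΓ hc hr, measure_density] at h
  rw [gaussForm_smul_self, _root_.map_smul, norm_smul, mul_pow, norm_inv,
    inv_pow, inv_pow, Real.norm_eq_abs, sq_abs, mul_left_comm, mul_left_comm (1 + γ)]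
  exact ⟨mul_le_mul_of_nonneg_left h.1 (by positivity),
    mul_le_mul_of_nonneg_left h.2 (by positivity)⟩

/-- Without boundedness the real supremum defining `lipConst` would be the default value $0$ and
would not dominate the quotients. -/
lemma bddAbove_lipConst (hΓ : Γ.PosDef) (hc : 0 < c) (hr : 0 < r) (θs : Param k p) (ρ : ℝ) :
    BddAbove ((fun θ => kernelNorm (gaussianKernel Γ c r) (phi Γ θ - phi Γ θs) / ‖θ - θs‖) ''
      {θ | θ ≠ θs ∧ ‖θ - θs‖ < ρ}) := by
  obtain ⟨L, hL0, hL⟩ := exists_norm_mixL1Deriv_le hΓ θs ρ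
  refine ⟨√‖gaussForm hΓ hc hr‖ * L, ?_⟩
  rintro _ ⟨θ, ⟨hne, hθ⟩, rfl⟩
  have h1 := norm_mixL1_sub_le hΓ hL hθ
  have hpos : 0 < ‖θ - θs‖ := norm_pos_iff.2 (sub_ne_zero.2 hne)
  simp only
  rw [div_le_iff₀ hpos, kernelNorm, ← density_mixL1 hΓ, ← density_mixL1 hΓ, ← density_sub,
    kernelNormSq_eq_gaussForm hΓ hc hr, mul_assoc]
  set f := mixL1 hΓ θ - mixL1 hΓ θs
  calc √(gaussForm hΓ hc hr f f) ≤ √(‖gaussForm hΓ hc hr‖ * ‖f‖ ^ 2) := by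
        refine Real.sqrt_le_sqrt ((le_abs_self _).trans ?_)
        rw [pow_two, ← mul_assoc]
        exact (gaussForm hΓ hc hr).le_opNorm₂ f f
    _ = √‖gaussForm hΓ hc hr‖ * ‖f‖ := by
        rw [Real.sqrt_mul (by positivity), Real.sqrt_sq (norm_nonneg _)]
    _ ≤ _ := by gcongr

omit [NeZero p] in
lemma lipConst_nonneg (θs : Param k p) (ρ : ℝ) :
    0 ≤ lipConst Γ (gaussianKernel Γ c r) θs ρ := by
  refine Real.sSup_nonneg ?_
  rintro _ ⟨θ, -, rfl⟩
  exact div_nonneg (Real.sqrt_nonneg _) (norm_nonneg _)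

/-- The Lipschitz constant bounds the tangent vectors. -/
lemma gaussForm_mixL1Deriv_le_lipConst (hΓ : Γ.PosDef) (hc : 0 < c) (hr : 0 < r) (θs : Param k p)
    {ρ : ℝ} (hρ : 0 < ρ) (e : Param k p) :
    gaussForm hΓ hc hr (mixL1Deriv hΓ θs e) (mixL1Deriv hΓ θs e)
      ≤ (lipConst Γ (gaussianKernel Γ c r) θs ρ * ‖e‖) ^ 2 := by
  rcases eq_or_ne e 0 with rfl | he
  · simp
  have hB := continuous_gaussForm_self (hΓ := hΓ) (hc := hc) (hr := hr)
  refine le_of_tendsto ((hB.tendsto _).comp (tendsto_slope_mixL1 hΓ θs e)) ?_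
  filter_upwards [(tendsto_line θs e).eventually (Metric.ball_mem_nhds θs hρ),
    self_mem_nhdsWithin] with s hs hs0
  have hs0 : s ≠ 0 := hs0
  have hse : s • e ≠ 0 := smul_ne_zero hs0 he
  have h1 : kernelNorm (gaussianKernel Γ c r) (phi Γ (θs + s • e) - phi Γ θs) / ‖θs + s • e - θs‖
      ≤ lipConst Γ (gaussianKernel Γ c r) θs ρ := le_csSup (bddAbove_lipConst hΓ hc hr θs ρ)
    ⟨θs + s • e, ⟨by simpa using hse, mem_ball_iff_norm.1 hs⟩, rfl⟩
  rw [add_sub_cancel_left, div_le_iff₀ (norm_pos_iff.2 hse), kernelNorm, ← density_mixL1 hΓ, ← density_mixL1 hΓ,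
    ← density_sub, kernelNormSq_eq_gaussForm hΓ hc hr, norm_smul] at h1
  have h2 := Real.sqrt_le_iff.1 h1
  simp only [Function.comp_def, gaussForm_smul_self]
  have hs2 : 0 < s ^ 2 := by positivity
  rw [inv_pow, inv_mul_le_iff₀ hs2]
  refine h2.2.trans_eq ?_
  rw [mul_left_comm, mul_pow, Real.norm_eq_abs, sq_abs]

lemma gaussForm_gaussL1_zero
    (hK : KernelAssumption k Γ (gaussianKernel Γ c r) ε cK) :
    gaussForm hΓ hc hr (gaussL1 hΓ 0) (gaussL1 hΓ 0) = 1 := by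
  have h := hK.norm_gaussian 0
  rw [kernelNorm, Real.sqrt_eq_one, ← density_gaussL1 hΓ, kernelNormSq_eq_gaussForm hΓ hc hr] at h
  exact h

lemma coherence_sum_le (hK : KernelAssumption k Γ (gaussianKernel Γ c r) ε cK) {θs : Param k p}
    (hθs : θs ∈ Theta k Γ ε R) (e : Param k p) :
    (1 - cK) * ∑ i, (e.fst i ^ 2 + θs.fst i ^ 2 * (1 / (r + 2) * mahalSq Γ (e.snd i)))
      ≤ gaussForm hΓ hc hr (mixL1Deriv hΓ θs e) (mixL1Deriv hΓ θs e) := by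
  have h1 := gaussForm_gaussL1_zero (hΓ := hΓ) (hc := hc) (hr := hr) hK
  have h := hK.coherence (fun i => θs.snd i) hθs.1 (fun i => e.fst i) (fun i => θs.fst i)
    (fun i => e.snd i)
  simp only [← density_gaussL1 hΓ, ← density_gaussL1Deriv hΓ, ← density_smul, ← density_add,
    ← density_sum, kernelNormSq_eq_gaussForm hΓ hc hr, ← mixL1Deriv_apply,
    gaussForm_add_self h1] at h
  exact h

variable [NeZero k]

/-- Test coherence on a single component of amplitude $1$: it reads $1-c_K\le1$. The sign is needed
for $\sqrt{1+c_K}\ge1$. -/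
lemma coherence_nonneg (hΓ : Γ.PosDef) (hc : 0 < c) (hr : 0 < r)
    (hK : KernelAssumption k Γ (gaussianKernel Γ c r) ε cK) {θs : Param k p}
    (hθs : θs ∈ Theta k Γ ε R) : 0 ≤ cK := by
  have h1 := gaussForm_gaussL1_zero (hΓ := hΓ) (hc := hc) (hr := hr) hK
  have h := coherence_sum_le (hΓ := hΓ) (hc := hc) (hr := hr) hK hθs
    (WithLp.toLp 2 (EuclideanSpace.single 0 1, 0))
  have h2 := gaussForm_add_self (hΓ := hΓ) (hc := hc) (hr := hr) h1 (θs.snd 0) 0 1 0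
  rw [mixL1Deriv_apply] at h
  simp [mahalSq, ite_smul] at h h2
  linarith

/-- Coherence splits the tangent vector into components, orthogonality splits each into amplitude
and mean parts, and $|a_1|\le|a_i|$ gives a common lower bound for the mean parts. -/
lemma mul_norm_sq_le_gaussForm_mixL1Deriv (hcK : cK < 1)
    (hK : KernelAssumption k Γ (gaussianKernel Γ c r) ε cK) {θs : Param k p}
    (hθs : θs ∈ Theta k Γ ε R) (ha : Monotone fun i => |θs.fst i|) (e : Param k p) :
    (1 - cK) * min 1 (dConst Γ (gaussianKernel Γ c r) * |θs.fst 0| ^ 2) * ‖e‖ ^ 2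
      ≤ gaussForm hΓ hc hr (mixL1Deriv hΓ θs e) (mixL1Deriv hΓ θs e) := by
  have h1 := gaussForm_gaussL1_zero (hΓ := hΓ) (hc := hc) (hr := hr) hK
  refine le_trans ?_ (coherence_sum_le (hΓ := hΓ) (hc := hc) (hr := hr) hK hθs e)
  rw [mul_assoc, param_norm_sq, Finset.mul_sum]
  refine mul_le_mul_of_nonneg_left (Finset.sum_le_sum fun i _ => ?_) (by linarith)
  rw [mul_add]
  have hd := dConst_pos (hΓ := hΓ) (hc := hc) (hr := hr) h1
  refine add_le_add (mul_le_of_le_one_left (sq_nonneg _) (min_le_left _ _)) ?_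
  calc _ ≤ dConst Γ (gaussianKernel Γ c r) * |θs.fst 0| ^ 2 * ‖e.snd i‖ ^ 2 := by
        gcongr; exact min_le_right _ _
    _ = |θs.fst 0| ^ 2 * (dConst Γ (gaussianKernel Γ c r) * ‖e.snd i‖ ^ 2) := by ring
    _ ≤ |θs.fst i| ^ 2 * (1 / (r + 2) * mahalSq Γ (e.snd i)) := by
        refine mul_le_mul (pow_le_pow_left₀ (abs_nonneg _) (ha (Fin.zero_le i)) 2)
          (dConst_mul_sq_le (hΓ := hΓ) (hc := hc) (hr := hr) h1 _) (by positivity) (by positivity)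
    _ = _ := by rw [sq_abs]

omit [NeZero k] in
/-- The measurements of the derivative of a component. -/
lemma norm_measureCLM_gaussL1Deriv_le (hΓ : Γ.PosDef) (hc : 0 < c) (hr : 0 < r) (hγ : 0 ≤ 1 + γ)
    (h1 : gaussForm hΓ hc hr (gaussL1 hΓ 0) (gaussL1 hΓ 0) = 1)
    (hRIP : HasRIP α (gaussianKernel Γ c r) (secants (Model k Γ ε R)) γ)
    {θ : Param k p} (hθ : θ ∈ Theta k Γ ε R) (i : Fin k) (hi : θ.fst i ≠ 0) (w : Space p) :
    ‖measureCLM α (gaussL1Deriv hΓ (θ.snd i) w)‖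
      ≤ √(1 + γ) * √(DConst Γ (gaussianKernel Γ c r)) * ‖w‖ := by
  -- Moving only the $i$-th mean gives the tangent vector $a_i\partial_w\mu_{t_i}$. Since $a_i\ne0$,
  -- the factor $a_i^2$ cancels.
  have h := (HasRIP.mixL1Deriv (hΓ := hΓ) (hc := hc) (hr := hr) hRIP hθ
    (WithLp.toLp 2 (0, WithLp.toLp 2 (Pi.single i w)))).2
  have e : mixL1Deriv hΓ θ (WithLp.toLp 2 (0, WithLp.toLp 2 (Pi.single i w)))
      = θ.fst i • gaussL1Deriv hΓ (θ.snd i) w := by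
    rw [mixL1Deriv_apply, Finset.sum_eq_single i]
    · simp
    · intro j _ hj
      simp [hj]
    · simp
  rw [e, gaussForm_smul_self, _root_.map_smul, norm_smul, mul_pow, Real.norm_eq_abs, sq_abs,
    mul_left_comm, gaussForm_gaussL1Deriv_self h1] at h
  have h2 := le_of_mul_le_mul_left h (by positivity)
  refine (abs_le_of_sq_le_sq' (h2.trans ?_) (by positivity)).2
  rw [mul_pow, mul_pow, Real.sq_sqrt hγ,
    Real.sq_sqrt (DConst_pos (hΓ := hΓ) (hc := hc) (hr := hr) h1).le, mul_assoc, mul_comm (DConst _ _)]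
  exact mul_le_mul_of_nonneg_left (mahalSq_le_DConst (hΓ := hΓ) (hc := hc) (hr := hr) h1 w) hγ

lemma norm_measureCLM_gaussL1Deriv₂_le (hΓ : Γ.PosDef) (α : Fin m → (Space p →ᵇ ℂ))
    (w t : Space p) :
    ‖measureCLM α (gaussL1Deriv₂ hΓ w t)‖ ≤ 2 * DAConst hΓ.isHermitian α * ‖w‖ ^ 2 := by
  have hint : 0 ≤ ∫ x, gaussianDensity Γ 0 x := integral_nonneg fun x => (Real.exp_pos _).le
  calc _ ≤ √(∑ l, ‖α l‖ ^ 2) * (2 * mahalSq Γ w * ∫ x, gaussianDensity Γ 0 x) :=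
        (norm_measureCLM_le α _).trans (by gcongr; exact norm_gaussL1Deriv₂_le hΓ w t)
    _ ≤ √(∑ l, ‖α l‖ ^ 2) * (2 * (1 / lambdaMin hΓ.isHermitian * ‖w‖ ^ 2) *
          ∫ x, gaussianDensity Γ 0 x) := by gcongr; exact mahalSq_le hΓ w
    _ = √(∑ l, ‖α l‖ ^ 2) * (1 / lambdaMin hΓ.isHermitian * ∫ x, gaussianDensity Γ 0 x) *
          (2 * ‖w‖ ^ 2) := by ring
    _ ≤ DAConst hΓ.isHermitian α * (2 * ‖w‖ ^ 2) := by
        rw [DAConst]; gcongr; exact le_max_left _ _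
    _ = _ := by ring

omit [NeZero p] in
lemma DAConst_nonneg (hΓ : Γ.PosDef) (α : Fin m → (Space p →ᵇ ℂ)) :
    0 ≤ DAConst hΓ.isHermitian α := by
  refine mul_nonneg (Real.sqrt_nonneg _) (le_max_of_le_right (integral_nonneg fun x => ?_))
  exact mul_nonneg (norm_nonneg _) (Real.exp_pos _).le

omit [NeZero k] in
/-- The second derivative of the measurements of a mixture. -/
lemma norm_measureCLM_mixL1Deriv₂_le (hΓ : Γ.PosDef) (hc : 0 < c) (hr : 0 < r) (hγ : 0 ≤ 1 + γ)
    (h1 : gaussForm hΓ hc hr (gaussL1 hΓ 0) (gaussL1 hΓ 0) = 1)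
    (hRIP : HasRIP α (gaussianKernel Γ c r) (secants (Model k Γ ε R)) γ)
    {θ : Param k p} (hθ : θ ∈ Theta k Γ ε R) (h0 : ∀ i, θ.fst i ≠ 0) {a : ℝ}
    (ha : ∀ i, |θ.fst i| ≤ a) (e : Param k p) :
    ‖measureCLM α (mixL1Deriv₂ hΓ e θ)‖ ≤ (√(1 + γ) * √(DConst Γ (gaussianKernel Γ c r)) +
      2 * a * DAConst hΓ.isHermitian α) * ‖e‖ ^ 2 := by
  have hD := DAConst_nonneg hΓ α
  rw [mixL1Deriv₂, map_sum, param_norm_sq, Finset.mul_sum]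
  refine (norm_sum_le _ _).trans (Finset.sum_le_sum fun i _ => ?_)
  rw [_root_.map_add, _root_.map_smul, _root_.map_smul]
  refine (norm_add_le _ _).trans ?_
  rw [norm_smul, norm_smul, Real.norm_eq_abs, Real.norm_eq_abs, abs_mul, abs_two]
  set v := |e.fst i| with hv
  set w := ‖e.snd i‖ with hw
  have hv2 : e.fst i ^ 2 = v ^ 2 := (sq_abs _).symm
  have hv0 : 0 ≤ v := abs_nonneg _
  have hw0 : 0 ≤ w := norm_nonneg _
  have ha0 : 0 ≤ a := (abs_nonneg _).trans (ha i)
  have b1 := mul_le_mul_of_nonneg_left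
    (norm_measureCLM_gaussL1Deriv_le hΓ hc hr hγ h1 hRIP hθ i (h0 i) (e.snd i))
    (by positivity : 0 ≤ 2 * v)
  have b2 := mul_le_mul (ha i) (norm_measureCLM_gaussL1Deriv₂_le hΓ α (e.snd i) (θ.snd i))
    (norm_nonneg _) ha0
  rw [hv2]
  set S := √(1 + γ) * √(DConst Γ (gaussianKernel Γ c r)) with hS
  have hS0 : 0 ≤ S := by positivity
  -- The factor $2$ of the mixed amplitude–mean derivative is absorbed by $2vw\le v^2+w^2$.
  have b3 : 2 * v * (S * w) ≤ S * (v ^ 2 + w ^ 2) := by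
    nlinarith [mul_nonneg hS0 (sq_nonneg (v - w))]
  have b4 : 0 ≤ 2 * a * DAConst hΓ.isHermitian α * v ^ 2 := by positivity
  nlinarith

end Basin

/-! ### The objective along segments from the minimizer, and the choice of the radius. -/

section Measurements

variable {k p m : ℕ} {Γ : Matrix (Fin p) (Fin p) ℝ} [NeZero p]

lemma hasFDerivAt_measureCLM_mixL1 (hΓ : Γ.PosDef) (α : Fin m → (Space p →ᵇ ℂ)) (θ : Param k p) :
    HasFDerivAt (fun θ => measureCLM α (mixL1 hΓ θ))
      ((measureCLM α).comp (mixL1Deriv hΓ θ)) θ :=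
  HasFDerivAt.comp (g := measureCLM α) θ (measureCLM α).hasFDerivAt (hasFDerivAt_mixL1 hΓ θ)

lemma hasDerivAt_measureCLM_mixL1 (hΓ : Γ.PosDef) (α : Fin m → (Space p →ᵇ ℂ)) (θ e : Param k p)
    (s : ℝ) : HasDerivAt (fun s : ℝ => measureCLM α (mixL1 hΓ (θ + s • e)))
      (measureCLM α (mixL1Deriv hΓ (θ + s • e) e)) s :=
  HasFDerivAt.comp_hasDerivAt (l := measureCLM α) s (measureCLM α).hasFDerivAt
    (hasDerivAt_mixL1 hΓ θ e s)

lemma hasDerivAt_measureCLM_mixL1Deriv (hΓ : Γ.PosDef) (α : Fin m → (Space p →ᵇ ℂ))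
    (θ e : Param k p) (s : ℝ) :
    HasDerivAt (fun s : ℝ => measureCLM α (mixL1Deriv hΓ (θ + s • e) e))
      (measureCLM α (mixL1Deriv₂ hΓ e (θ + s • e))) s :=
  HasFDerivAt.comp_hasDerivAt (l := measureCLM α) s (measureCLM α).hasFDerivAt
    (hasDerivAt_mixL1Deriv hΓ θ e s)

lemma objective_eq (hΓ : Γ.PosDef) (α : Fin m → (Space p →ᵇ ℂ)) (y : EuclideanSpace ℂ (Fin m)) :
    objective (k := k) Γ α y = fun θ => ‖measureCLM α (mixL1 hΓ θ) - y‖ ^ 2 := by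
  ext θ
  rw [objective, measure_phi hΓ]

lemma inner_gradient_objective (hΓ : Γ.PosDef) (α : Fin m → (Space p →ᵇ ℂ))
    (y : EuclideanSpace ℂ (Fin m)) (θ v : Param k p) :
    inner ℝ (gradient (objective Γ α y) θ) v
      = 2 * inner ℝ (measureCLM α (mixL1 hΓ θ) - y) (measureCLM α (mixL1Deriv hΓ θ v)) := by
  rw [objective_eq hΓ]
  exact inner_gradient_norm_sq (hasFDerivAt_measureCLM_mixL1 hΓ α θ) y v

/-- The gradient of the objective is Lipschitz at a parameter with exact measurements. -/
lemma norm_gradient_objective_le (hΓ : Γ.PosDef) (α : Fin m → (Space p →ᵇ ℂ)) {θs θ : Param k p}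
    {β L : ℝ} (hL0 : 0 ≤ L) (hL : ∀ θ, ‖θ - θs‖ < β → ‖mixL1Deriv hΓ θ‖ ≤ L)
    (hθ : ‖θ - θs‖ < β) :
    ‖gradient (objective Γ α (measureCLM α (mixL1 hΓ θs))) θ‖
      ≤ 2 * ‖measureCLM α‖ ^ 2 * L ^ 2 * ‖θ - θs‖ := by
  set y := measureCLM α (mixL1 hΓ θs) with hy
  have h1 := norm_mixL1_sub_le hΓ hL hθ
  have h2 : ‖measureCLM α (mixL1 hΓ θ) - y‖ ≤ ‖measureCLM α‖ * (L * ‖θ - θs‖) := by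
    rw [hy, ← _root_.map_sub]
    exact (measureCLM α).le_opNorm_of_le h1
  set G := gradient (objective Γ α y) θ with hG
  have h3 : ‖measureCLM α (mixL1Deriv hΓ θ G)‖ ≤ ‖measureCLM α‖ * (L * ‖G‖) :=
    (measureCLM α).le_opNorm_of_le ((mixL1Deriv hΓ θ).le_of_opNorm_le (hL θ hθ) G)
  rcases (norm_nonneg G).eq_or_lt with h0 | h0
  · rw [← h0]; positivity
  -- The gradient formula is tested on the gradient $G$ itself, and one factor $\|G\|$ is cancelled.
  refine le_of_mul_le_mul_right ?_ h0
  rw [← pow_two, ← real_inner_self_eq_norm_sq, inner_gradient_objective]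
  calc _ ≤ 2 * (‖measureCLM α (mixL1 hΓ θ) - y‖ * ‖measureCLM α (mixL1Deriv hΓ θ G)‖) := by
        gcongr; exact real_inner_le_norm _ _
    _ ≤ 2 * ((‖measureCLM α‖ * (L * ‖θ - θs‖)) * (‖measureCLM α‖ * (L * ‖G‖))) := by gcongr
    _ = _ := by ring

lemma continuousAt_objective (hΓ : Γ.PosDef) (α : Fin m → (Space p →ᵇ ℂ))
    (y : EuclideanSpace ℂ (Fin m)) (θ : Param k p) : ContinuousAt (objective Γ α y) θ := by
  rw [objective_eq hΓ]
  exact continuousAt_norm_sub_sq (hasFDerivAt_measureCLM_mixL1 hΓ α θ) y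

/-- For noiseless data a minimizer over the model reproduces the measurements. -/
lemma eq_measureCLM_of_minimizer (hΓ : Γ.PosDef) {α : Fin m → (Space p →ᵇ ℂ)} {ε R : ℝ}
    {x₀ : SignedMeasure (Space p)} (hx₀ : x₀ ∈ Model k Γ ε R) {y : EuclideanSpace ℂ (Fin m)}
    (hy : y = measure α x₀) {θs : Param k p}
    (hmin : ∀ θ ∈ Theta k Γ ε R, objective Γ α y θs ≤ objective Γ α y θ) :
    y = measureCLM α (mixL1 hΓ θs) := by
  obtain ⟨θ₀, hθ₀, rfl⟩ := hx₀
  have h1 := hmin θ₀ hθ₀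
  rw [measure_phi hΓ] at hy
  simp only [objective_eq hΓ, ← hy, sub_self, norm_zero] at h1
  have h2 : ‖measureCLM α (mixL1 hΓ θs) - y‖ = 0 := by
    rw [← sq_eq_zero_iff]
    exact le_antisymm (by simpa using h1) (sq_nonneg _)
  exact (sub_eq_zero.1 (norm_eq_zero.1 h2)).symm

/-- The gradient of the objective is strongly monotone along the segments from `θs`. -/
lemma sq_mul_le_inner_gradient_objective {c r ε γ R cK : ℝ} [NeZero k] {α : Fin m → (Space p →ᵇ ℂ)}
    (hΓ : Γ.PosDef) (hε : 0 < ε) (hc : 0 < c) (hr : 0 < r) (hγ : 0 ≤ 1 + γ)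
    (hK : KernelAssumption k Γ (gaussianKernel Γ c r) ε cK)
    (hRIP : HasRIP α (gaussianKernel Γ c r) (secants (Model k Γ (ε / 2) R)) γ)
    {θs θ : Param k p} (hθs : θs ∈ Theta k Γ ε R)
    (ha₀ : 0 < |θs.fst 0|) (ha : Monotone fun i => |θs.fst i|) {β κ M : ℝ}
    (hβε : β ≤ ε * √(lambdaMin hΓ.isHermitian) / 8) (hβa : β ≤ |θs.fst 0| / 2)
    (hR : ∀ i, ‖θs.snd i‖ ≤ R - 2 * β) (hκ : 0 ≤ κ) (hM : 0 ≤ M)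
    (h4 : √(1 + γ) * √(DConst Γ (gaussianKernel Γ c r))
      + 2 * (3 / 2 * |θs.fst ⊤|) * DAConst hΓ.isHermitian α ≤ 3 / 2 * M)
    (hβM : 8 * M * β ≤ κ)
    (hlow : κ * ‖θ - θs‖ ≤ ‖measureCLM α (mixL1Deriv hΓ θs (θ - θs))‖) (hθ : ‖θ - θs‖ < β) :
    κ ^ 2 * ‖θ - θs‖ ^ 2
      ≤ inner ℝ (gradient (objective Γ α (measureCLM α (mixL1 hΓ θs))) θ) (θ - θs) := by
  have hnorm := gaussForm_gaussL1_zero (hΓ := hΓ) (hc := hc) (hr := hr) hK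
  set e := θ - θs with he
  have hsum : θs + (1 : ℝ) • e = θ := by rw [one_smul, he, add_sub_cancel]
  have key := inner_sub_deriv_ge
    (h := fun s : ℝ => measureCLM α (mixL1 hΓ (θs + s • e)))
    (h' := fun s : ℝ => measureCLM α (mixL1Deriv hΓ (θs + s • e) e))
    (h'' := fun s : ℝ => measureCLM α (mixL1Deriv₂ hΓ e (θs + s • e)))
    (hasDerivAt_measureCLM_mixL1 hΓ α θs e)
    (hasDerivAt_measureCLM_mixL1Deriv hΓ α θs e)
    (fun s hs => by
      have hball : ‖θs + s • e - θs‖ < β := by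
        rw [add_sub_cancel_left, norm_smul, Real.norm_of_nonneg hs.1]
        exact (mul_le_of_le_one_left (norm_nonneg _) hs.2).trans_lt hθ
      -- Along the segment, amplitudes stay nonzero, as the tangent bound requires, and at most
      -- $\frac32|a_k|$.
      have hamp : ∀ i, |(θs + s • e).fst i - θs.fst i| < |θs.fst 0| / 2 := fun i =>
        ((abs_fst_le (θs + s • e - θs) i).trans_lt hball).trans_le hβa
      have hsep := mem_Theta_half_of_norm_sub_lt hΓ hε hθs hβε hR hball
      have h2 := norm_measureCLM_mixL1Deriv₂_le hΓ hc hr hγ hnorm hRIP hsep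
        (fun i h0 => by
          have h3 := hamp i
          rw [h0, zero_sub, abs_neg] at h3
          have h4 : |θs.fst 0| ≤ |θs.fst i| := ha (Fin.zero_le i)
          linarith)
        (a := 3 / 2 * |θs.fst ⊤|)
        (fun i => by
          have h3 := abs_sub_abs_le_abs_sub ((θs + s • e).fst i) (θs.fst i)
          have h4 : |θs.fst i| ≤ |θs.fst ⊤| := ha le_top
          have h5 : |θs.fst 0| ≤ |θs.fst ⊤| := ha le_top
          linarith [hamp i])
        e
      -- The bound is $\frac32M\|e\|^2\le\frac32M\beta\|e\|\le\frac3{16}\kappa\|e\|$, and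
      -- $\frac3{16}<\frac15$.
      refine h2.trans ?_
      have h5 := hlow
      simp only [zero_smul, add_zero]
      have h6 : M * ‖e‖ ^ 2 ≤ M * β * ‖e‖ := by
        rw [pow_two, ← mul_assoc]
        gcongr
      have h7 := mul_le_mul_of_nonneg_right hβM (norm_nonneg e)
      have h8 := mul_le_mul_of_nonneg_right h4 (sq_nonneg ‖e‖)
      have h9 : 0 ≤ κ * ‖e‖ := by positivity
      linarith)
  simp only [zero_smul, add_zero, hsum] at key
  rw [inner_gradient_objective hΓ]
  have h5 := pow_le_pow_left₀ (by positivity) hlow 2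
  rw [mul_pow] at h5
  linarith

end Measurements

/-- The ball of radius `betaGMM` around a constrained minimizer is a basin of attraction. -/
lemma isBasin_betaGMM {k p m : ℕ} [NeZero k] [NeZero p]
    (Γ : Matrix (Fin p) (Fin p) ℝ) (hΓ : Γ.PosDef) (ε R : ℝ) (hε : 0 < ε)
    (c r : ℝ) (hc : 0 < c) (hr : 0 < r) (cK : ℝ) (hcK : cK < 1)
    (hK : KernelAssumption k Γ (gaussianKernel Γ c r) ε cK)
    (α : Fin m → BoundedContinuousFunction (Space p) ℂ) (γ : ℝ) (hγ : γ < 1)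
    (hRIP : HasRIP α (gaussianKernel Γ c r)
      (secants (Model k Γ (ε / 2) R)) γ)
    (x₀ : MeasureTheory.SignedMeasure (Space p)) (hx₀ : x₀ ∈ Model k Γ ε R)
    (y : EuclideanSpace ℂ (Fin m)) (hy : y = measure α x₀)
    (θs : Param k p) (hθs : θs ∈ Theta k Γ ε R)
    (hmin : ∀ θ ∈ Theta k Γ ε R, objective Γ α y θs ≤ objective Γ α y θ)
    (ha₀ : 0 < |θs.fst 0|) (ha : Monotone fun i => |θs.fst i|)
    (hR : ∀ i, ‖θs.snd i‖ ≤
      R - 2 * betaGMM hΓ.isHermitian α (gaussianKernel Γ c r) ε γ cK θs) :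
    IsBasin (objective Γ α y) θs
      {θ | ‖θ - θs‖ <
        betaGMM hΓ.isHermitian α (gaussianKernel Γ c r) ε γ cK θs} := by
  have hnorm := gaussForm_gaussL1_zero (hΓ := hΓ) (hc := hc) (hr := hr) hK
  have hcK0 := coherence_nonneg hΓ hc hr hK hθs
  have hθs' : θs ∈ Theta k Γ (ε / 2) R :=
    ⟨fun i j hij => lt_trans (by linarith) (hθs.1 i j hij), hθs.2⟩
  set K := gaussianKernel Γ c r with hKdef
  have hdK : 0 < dConst Γ K := dConst_pos (hΓ := hΓ) (hc := hc) (hr := hr) hnorm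
  have hDK : 0 < DConst Γ K := DConst_pos (hΓ := hΓ) (hc := hc) (hr := hr) hnorm
  have hDA := DAConst_nonneg hΓ α
  have hlam := lambdaMin_pos hΓ
  set μ := min 1 (dConst Γ K * |θs.fst 0| ^ 2) with hμ
  have hμ0 : 0 < μ := lt_min one_pos (by positivity)
  have hB : ∀ e, (1 - cK) * μ * ‖e‖ ^ 2
      ≤ gaussForm hΓ hc hr (mixL1Deriv hΓ θs e) (mixL1Deriv hΓ θs e) :=
    mul_norm_sq_le_gaussForm_mixL1Deriv hcK hK hθs ha
  have hrip := fun e => HasRIP.mixL1Deriv (hΓ := hΓ) (hc := hc) (hr := hr) hRIP hθs' e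
  have hcK' : 0 < 1 - cK := by linarith
  have hγ' : 0 < 1 - γ := by linarith
  -- a nonzero direction
  obtain ⟨e₀, he₀⟩ : ∃ e₀ : Param k p, 0 < ‖e₀‖ :=
    ⟨θs, (ha₀.trans_le (abs_fst_le θs 0))⟩
  -- At a tangent vector of positive kernel norm, the two isometry bounds are compatible only if
  -- $1-\gamma\le1+\gamma$.
  have hγ0 : 0 ≤ γ := by
    have h1 := (hrip e₀).1.trans (hrip e₀).2
    have h2 : 0 < gaussForm hΓ hc hr (mixL1Deriv hΓ θs e₀) (mixL1Deriv hΓ θs e₀) :=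
      lt_of_lt_of_le (by positivity) (hB e₀)
    linarith [le_of_mul_le_mul_right h1 h2]
  have hγ1 : 0 < 1 + γ := by linarith
  -- the constants
  set β₀ := betaZero hΓ.isHermitian ε θs with hβ₀
  have hβ₀0 : 0 < β₀ := lt_min (by positivity) (by positivity)
  set C := lipConst Γ K θs (2 * β₀) with hC
  have hC0 : 0 ≤ C := lipConst_nonneg θs _
  set κ := √((1 - γ) * (1 - cK) * μ) with hκ
  have hκ0 : 0 < κ := Real.sqrt_pos.2 (by positivity)
  have hκ2 : κ ^ 2 = (1 - γ) * (1 - cK) * μ := Real.sq_sqrt (by positivity)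
  have hlow : ∀ e, κ * ‖e‖ ≤ ‖measureCLM α (mixL1Deriv hΓ θs e)‖ := fun e => by
    refine (abs_le_of_sq_le_sq' ?_ (norm_nonneg _)).2
    refine le_trans ?_ (hrip e).1
    rw [mul_pow, hκ2, mul_assoc (1 - γ), mul_assoc (1 - γ)]
    exact mul_le_mul_of_nonneg_left (hB e) hγ'.le
  have hup : ∀ e, ‖measureCLM α (mixL1Deriv hΓ θs e)‖ ≤ √(1 + γ) * C * ‖e‖ := fun e => by
    refine (abs_le_of_sq_le_sq' ?_ (by positivity)).2
    refine (hrip e).2.trans ?_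
    rw [mul_assoc, mul_pow, Real.sq_sqrt hγ1.le]
    exact mul_le_mul_of_nonneg_left
      (gaussForm_mixL1Deriv_le_lipConst hΓ hc hr θs (by positivity) e) hγ1.le
  -- This explains $C_{\phi,\theta^*}\sqrt{1+\gamma}$ in the denominator of the radius: it trades
  -- one factor of $\kappa^2$, so that $\beta\le\kappa^2/(8C\sqrt{1+\gamma}M)$ becomes
  -- $8M\beta\le\kappa$. It also forces $C>0$.
  have hκC : κ ≤ √(1 + γ) * C := le_of_mul_le_mul_right ((hlow e₀).trans (hup e₀)) he₀
  have hCpos : 0 < C := pos_of_mul_pos_right (hκ0.trans_le hκC) (Real.sqrt_nonneg _)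
  set M := √(1 + γ) * √(1 + cK) * √(DConst Γ K) + 2 * |θs.fst ⊤| * DAConst hΓ.isHermitian α
    with hM
  have hM0 : 0 < M := by
    have : 0 < √(1 + γ) * √(1 + cK) * √(DConst Γ K) := by
      have : 0 < 1 + cK := by linarith
      positivity
    positivity
  set β := betaGMM hΓ.isHermitian α K ε γ cK θs with hβ
  have hden : 0 < 8 * C * √(1 + γ) * M := by positivity
  have hβ0 : 0 < β := lt_min hβ₀0 (div_pos (by positivity) hden)
  have hββ₀ : β ≤ β₀ := min_le_left _ _
  have hβε : β ≤ ε * √(lambdaMin hΓ.isHermitian) / 8 := hββ₀.trans (min_le_left _ _)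
  have hβa : β ≤ |θs.fst 0| / 2 := hββ₀.trans (min_le_right _ _)
  have hβM : 8 * M * β ≤ κ := by
    have h1 : β ≤ κ ^ 2 / (8 * C * √(1 + γ) * M) := hκ2 ▸ min_le_right _ _
    rw [le_div_iff₀ hden] at h1
    have h2 : 8 * M * β * (√(1 + γ) * C) ≤ κ * (√(1 + γ) * C) :=
      calc _ = β * (8 * C * √(1 + γ) * M) := by ring
        _ ≤ κ * κ := by rwa [← pow_two]
        _ ≤ _ := mul_le_mul_of_nonneg_left hκC hκ0.le
    exact le_of_mul_le_mul_right h2 (by positivity)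
  have hy' := eq_measureCLM_of_minimizer hΓ hx₀ hy hmin
  obtain ⟨L, hL0, hL⟩ := exists_norm_mixL1Deriv_le hΓ θs β
  refine isBasin_of_inner_gradient_ge (κ := κ ^ 2) (L := 2 * ‖measureCLM α‖ ^ 2 * L ^ 2) hβ0
    (by positivity) ?_ (fun θ hθ => ?_) (fun θ hθ => ?_)
  · exact continuousAt_objective hΓ α y θs
  · have h3 : √(1 + γ) * √(DConst Γ K) ≤ √(1 + γ) * √(1 + cK) * √(DConst Γ K) := by
      have : 1 ≤ √(1 + cK) := Real.one_le_sqrt.2 (by linarith)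
      rw [mul_right_comm]
      exact le_mul_of_one_le_right (by positivity) this
    -- The amplitude bound $\frac32|a_k|$ turns $2|a_k|D'_{A,K}$ into exactly $\frac32$ of itself;
    -- the other summand has room to spare.
    have h4 : √(1 + γ) * √(DConst Γ K)
        + 2 * (3 / 2 * |θs.fst ⊤|) * DAConst hΓ.isHermitian α ≤ 3 / 2 * M := by
      have : 0 ≤ √(1 + γ) * √(DConst Γ K) := by positivity
      rw [hM]
      linarith
    rw [hy']
    exact sq_mul_le_inner_gradient_objective hΓ hε hc hr hγ1.le hK hRIP hθs ha₀ ha hβε hβa hR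
      hκ0.le hM0.le h4 hβM (hlow _) hθ
  · rw [hy']
    exact norm_gradient_objective_le hΓ α hL0 hL hθ

end

end GMM

theorem theorem3 {k p m : ℕ} [NeZero k] [NeZero p]
    (Γ : Matrix (Fin p) (Fin p) ℝ) (hΓ : Γ.PosDef) (ε R : ℝ) (hε : 0 < ε)
    -- the kernel: Gaussian, with covariance proportional to `Γ`, and coherent
    (c r : ℝ) (hc : 0 < c) (hr : 0 < r) (cK : ℝ) (hcK : cK < 1)
    (hK : GMM.KernelAssumption k Γ (GMM.gaussianKernel Γ c r) ε cK)
    -- the measurements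
    (α : Fin m → BoundedContinuousFunction (GMM.Space p) ℂ) (γ : ℝ) (hγ : γ < 1)
    (hRIP : GMM.HasRIP α (GMM.gaussianKernel Γ c r)
      (GMM.secants (GMM.Model k Γ (ε / 2) R)) γ)
    -- noiseless data
    (x₀ : MeasureTheory.SignedMeasure (GMM.Space p)) (hx₀ : x₀ ∈ GMM.Model k Γ ε R)
    (y : EuclideanSpace ℂ (Fin m)) (hy : y = GMM.measure α x₀)
    -- the constrained minimizer
    (θs : GMM.Param k p) (hθs : θs ∈ GMM.Theta k Γ ε R)
    (hmin : ∀ θ ∈ GMM.Theta k Γ ε R, GMM.objective Γ α y θs ≤ GMM.objective Γ α y θ)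
    (ha₀ : 0 < |θs.fst 0|) (ha : Monotone fun i => |θs.fst i|)
    (hR : ∀ i, ‖θs.snd i‖ ≤
      R - 2 * GMM.betaGMM hΓ.isHermitian α (GMM.gaussianKernel Γ c r) ε γ cK θs) :
    GMM.IsBasin (GMM.objective Γ α y) θs
      {θ | ‖θ - θs‖ <
        GMM.betaGMM hΓ.isHermitian α (GMM.gaussianKernel Γ c r) ε γ cK θs} :=
  GMM.isBasin_betaGMM Γ hΓ ε R hε c r hc hr cK hcK hK α γ hγ hRIP x₀ hx₀ y hy θs hθs hmin ha₀ ha hR
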